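/- Let $P,Q$ be probability measures on $\mathbb{R}^k$. For a probability measure $\mu$ on $\mathbb{R}^k$ and $0<\gamma\le 1$, let $K_\mu(\gamma)$ be the set of measurable $\phi:\mathbb{R}^k\to[0,1]$ with $\int\phi\,d\mu\ge\gamma$ and $\int\|x\|^2\phi(x)\,\mu(dx)<\infty$, and put $$T_\mu(\phi)=\frac{\int x\,\phi(x)\,\mu(dx)}{\int\phi\,d\mu},\qquad C_\mu(\phi)=\frac{\int (x-T_\mu(\phi))(x-T_\mu(\phi))'\phi(x)\,\mu(dx)}{\int\phi\,d\mu}.$$ Let $\mathrm{MCD}_\gamma(\mu)$ be the set of all pairs $(T_\mu(\phi),C_\mu(\phi))$ where $\phi$ minimizes $\det C_\mu(\phi)$ over $K_\mu(\gamma)$; its elements are called MCD functionals at $\mu$ of level $\gamma$. For $r\in\mathbb{R}^k$ let $\tau_r(x)=x+r$ and $P_{r,\varepsilon}=(1-\varepsilon)P+\varepsilon\,Q\circ\tau_r^{-1}$. Let $\varepsilon\ge 0$ and $\varepsilon<\gamma<1-\varepsilon$, and suppose that $P(H)<\frac{\gamma-\varepsilon}{1-\varepsilon}$ for every (affine) hyperplane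 $H\subset\mathbb{R}^k$. Then: (i) For every fixed $r\in\mathbb{R}^k$, $\lim_{\eta\downarrow 0}\mathrm{MCD}_\gamma(P_{r,\eta})=\mathrm{MCD}_\gamma(P)$, in the following sense: for all sufficiently small $\eta>0$ the set $\mathrm{MCD}_\gamma(P_{r,\eta})$ is nonempty; and whenever $\eta_n\in(0,1)$, $\eta_n\to0$ and $x_n\in\mathrm{MCD}_\gamma(P_{r,\eta_n})$ for all $n$, the sequence $(x_n)$ has a convergent subsequence, and the limit of every convergent subsequence lies in $\mathrm{MCD}_\gamma(P)$. Similarly $\lim_{\|r\|\to\infty}\mathrm{MCD}_\gamma(P_{r,\varepsilon})=\mathrm{MCD}_{\gamma/(1-\varepsilon)}(P)$: the set $\mathrm{MCD}_\gamma(P_{r,\varepsilon})$ is nonempty for all sufficiently large $\|r\|$; and whenever $\|r_n\|\to\infty$ and $x_n\in\mathrm{MCD}_\gamma(P_{r_n,\varepsilon})$ for all $n$, the sequence $(x_n)$ has a convergent subsequence, and the limit of every convergent subsequence lies in $\mathrm{MCD}_{\gamma/(1-\varepsilon)}(P)$. (ii) If in addition $Q$ has bounded support, then there exists $r_0\ge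 0$ such that $\mathrm{MCD}_\gamma(P_{r,\varepsilon})=\mathrm{MCD}_{\gamma/(1-\varepsilon)}(P)$ (equality of sets) for all $r\in\mathbb{R}^k$ with $\|r\|\ge r_0$. -/

import Mathlib

open Filter Topology MeasureTheory

noncomputable section

/-- `ℝ^k` with its Euclidean norm. -/
abbrev Rk (k : ℕ) : Type := EuclideanSpace ℝ (Fin k)

/-- The class `K_P(γ)` of trimming functions: measurable `φ : ℝ^k → [0,1]` with
`∫ φ dP ≥ γ` and `∫ ‖x‖² φ(x) P(dx) < ∞`. -/
def trimmingClass {k : ℕ} (P : Measure (Rk k)) (γ : ℝ) : Set (Rk k → ℝ) :=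
  {φ | Measurable φ ∧ (∀ x, φ x ∈ Set.Icc (0 : ℝ) 1) ∧ γ ≤ ∫ x, φ x ∂P ∧
    Integrable (fun x => ‖x‖ ^ 2 * φ x) P}

/-- The trimmed mean `T_P(φ)`. -/
def trimmedMean {k : ℕ} (P : Measure (Rk k)) (φ : Rk k → ℝ) : Rk k :=
  (∫ x, φ x ∂P)⁻¹ • ∫ x, φ x • x ∂P

/-- The trimmed covariance matrix `C_P(φ)`, given entrywise. -/
def trimmedCov {k : ℕ} (P : Measure (Rk k)) (φ : Rk k → ℝ) : Matrix (Fin k) (Fin k) ℝ :=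
  Matrix.of fun i j => (∫ x, φ x ∂P)⁻¹ *
    ∫ x, (x - trimmedMean P φ) i * (x - trimmedMean P φ) j * φ x ∂P

/-- `φ` minimizes `det C_P` over `K_P(γ)`. -/
def IsMinimizingTrimming {k : ℕ} (P : Measure (Rk k)) (γ : ℝ) (φ : Rk k → ℝ) : Prop :=
  φ ∈ trimmingClass P γ ∧
    ∀ ψ ∈ trimmingClass P γ, (trimmedCov P φ).det ≤ (trimmedCov P ψ).det

/-- `MCD_γ(P)`: the set of all MCD functionals `(T_P(φ), C_P(φ))` at `P` of level `γ`
(a minimizing `φ` need not be unique). -/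
def MCD {k : ℕ} (γ : ℝ) (P : Measure (Rk k)) : Set (Rk k × Matrix (Fin k) (Fin k) ℝ) :=
  {p | ∃ φ, IsMinimizingTrimming P γ φ ∧ p = (trimmedMean P φ, trimmedCov P φ)}

/-- The mixture `P_{r,ε} = (1 - ε) P + ε Q ∘ τ_r⁻¹`, where `τ_r(x) = x + r`. -/
def contaminated {k : ℕ} (P Q : Measure (Rk k)) (r : Rk k) (ε : ℝ) : Measure (Rk k) :=
  ENNReal.ofReal (1 - ε) • P + ENNReal.ofReal ε • Q.map (fun x => x + r)

/-- `lim_l A = B` for a set-valued map `A`, in the sense of limit points: `A i` is eventually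
nonempty, and every choice of points of `A` along a sequence of parameters converging to `l` has
a convergent subsequence, and all its limit points belong to `B`. -/
def LimitPointsIn {ι X : Type*} [TopologicalSpace X] (l : Filter ι) (A : ι → Set X)
    (B : Set X) : Prop :=
  (∀ᶠ i in l, (A i).Nonempty) ∧
    ∀ (u : ℕ → ι) (x : ℕ → X), Tendsto u atTop l → (∀ n, x n ∈ A (u n)) →
      (∃ (s : ℕ → ℕ) (y : X), StrictMono s ∧ Tendsto (x ∘ s) atTop (𝓝 y)) ∧
      ∀ (s : ℕ → ℕ) (y : X), StrictMono s → Tendsto (x ∘ s) atTop (𝓝 y) → y ∈ B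

end

/-! Both limits are instances of one stability statement. On bounded sets the contaminated laws
converge in total variation to a finite measure `ν`: to `P` as the contamination weight tends to 0,
and to `(1 - ε) P` as the contamination is translated to infinity. Trimmed moments do not change
when the measure is scaled, so level `γ` at `(1 - ε) P` is level `γ / (1 - ε)` at `P`. The common
hypotheses are collected in `StablePerturbation`.

Compactness: the contamination can supply only its own weight, so an admissible trimming function
keeps asymptotically a mass `c` under `ν`, namely `γ` or `γ - ε`. Hyperplanes have mass less than
`c`, hence so do, uniformly, slabs of some fixed width (`exists_slab_bound`), and this bounds the
trimmed covariance from below. Comparison with the indicator of a ball bounds the minimal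
determinant from above; the two together bound trace and mean (`exists_uniform_bounds`).

Limits: trimming functions have weak limits, under which mass and mean converge while second moments
can only drop (`exists_trimming_of_tendsto`). A limit `C` of minimal covariances therefore dominates
the covariance of an admissible function at `ν`. Conversely `det C` is at most the minimal
determinant at `ν`, and strict monotonicity of the determinant forces equality. The same
semicontinuity gives existence (`MCD_nonempty`).

Bounded support: the tangent inequality for log det (`det_le_det_mul_exp`) shows that moving mass
from large to smaller Mahalanobis distance strictly lowers the determinant, so minimizers live in a
fixed ball. This supplies competitors for which local convergence of measures suffices. It also
gives part (ii): if `Q` has bounded support, a far translate of it misses that ball, and the two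
minimization problems coincide. -/

/-! ### Determinants, traces and quadratic forms of positive matrices. -/

section MatrixFacts

open Matrix

variable {k : ℕ}

/-- The quadratic form `x ↦ x' W x`. -/
def qform (W : Matrix (Fin k) (Fin k) ℝ) (x : Rk k) : ℝ := ∑ i, ∑ j, W i j * (x i * x j)

theorem qform_eq_dotProduct (W : Matrix (Fin k) (Fin k) ℝ) (x : Rk k) :
    qform W x = x.ofLp ⬝ᵥ (W *ᵥ x.ofLp) := by
  simp only [qform, dotProduct, mulVec, Finset.mul_sum]
  exact Finset.sum_congr rfl fun i _ => Finset.sum_congr rfl fun j _ => by ring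

theorem qform_one (x : Rk k) : qform (1 : Matrix (Fin k) (Fin k) ℝ) x = ‖x‖ ^ 2 := by
  rw [qform_eq_dotProduct, one_mulVec, EuclideanSpace.real_norm_sq_eq]
  simp [dotProduct, sq]

theorem qform_sub_left (A B : Matrix (Fin k) (Fin k) ℝ) (x : Rk k) :
    qform (A - B) x = qform A x - qform B x := by
  simp [qform, sub_mul, Finset.sum_sub_distrib]

theorem qform_vecMulVec (v x : Rk k) : qform (vecMulVec v v) x = (inner ℝ v x) ^ 2 := by
  rw [EuclideanSpace.inner_eq_star_dotProduct, sq, dotProduct, Finset.sum_mul_sum]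
  simp only [qform, vecMulVec_apply, star_trivial]
  exact Finset.sum_congr rfl fun i _ => Finset.sum_congr rfl fun j _ => by ring

theorem trace_vecMulVec_mul (v : Rk k) (C : Matrix (Fin k) (Fin k) ℝ) :
    (vecMulVec v v * C).trace = qform C v := by
  rw [trace_mul_comm]
  simp only [trace, mul_apply, diag_apply, vecMulVec_apply, qform]
  exact Finset.sum_congr rfl fun i _ => Finset.sum_congr rfl fun j _ => by ring

theorem posSemidef_of_qform_nonneg {W : Matrix (Fin k) (Fin k) ℝ} (hW : W.IsHermitian)
    (h : ∀ x, 0 ≤ qform W x) : W.PosSemidef :=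
  .of_dotProduct_mulVec_nonneg hW fun x => by
    simpa [qform_eq_dotProduct] using h (WithLp.toLp 2 x)

theorem Matrix.PosSemidef.qform_nonneg {W : Matrix (Fin k) (Fin k) ℝ} (hW : W.PosSemidef)
    (x : Rk k) : 0 ≤ qform W x := by
  simpa [qform_eq_dotProduct] using hW.dotProduct_mulVec_nonneg x.ofLp

theorem posDef_of_le_qform {W : Matrix (Fin k) (Fin k) ℝ} (hW : W.IsHermitian) {c : ℝ}
    (hc : 0 < c) (h : ∀ x, c * ‖x‖ ^ 2 ≤ qform W x) : W.PosDef :=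
  .of_dotProduct_mulVec_pos hW fun x hx => by
    have h1 := h (WithLp.toLp 2 x)
    rw [qform_eq_dotProduct] at h1
    have h2 : (WithLp.toLp 2 x : Rk k) ≠ 0 := by simpa using hx
    have : 0 < c * ‖(WithLp.toLp 2 x : Rk k)‖ ^ 2 := by positivity
    simpa using this.trans_le h1

/-- Apply `t ≤ exp (t - 1)` to each eigenvalue and multiply. -/
theorem det_le_exp_trace_sub {A : Matrix (Fin k) (Fin k) ℝ} (hA : A.PosSemidef) :
    A.det ≤ Real.exp (A.trace - k) := by
  have h1 : A.det = ∏ i, hA.1.eigenvalues i := by simpa using hA.1.det_eq_prod_eigenvalues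
  have h2 : A.trace = ∑ i, hA.1.eigenvalues i := by simpa using hA.1.trace_eq_sum_eigenvalues
  have h3 : A.trace - k = ∑ i, (hA.1.eigenvalues i - 1) := by simp [h2, Finset.sum_sub_distrib]
  rw [h1, h3, Real.exp_sum]
  refine Finset.prod_le_prod (fun i _ => hA.eigenvalues_nonneg i) fun i _ => ?_
  simpa using Real.add_one_le_exp (hA.1.eigenvalues i - 1)

open scoped MatrixOrder in
theorem Matrix.PosSemidef.exists_eq_transpose_mul {A : Matrix (Fin k) (Fin k) ℝ}
    (hA : A.PosSemidef) : ∃ B : Matrix (Fin k) (Fin k) ℝ, A = Bᴴ * B := by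
  obtain ⟨B, hB⟩ := CStarAlgebra.nonneg_iff_eq_star_mul_self.mp hA.nonneg
  exact ⟨B, hB⟩

theorem Matrix.PosSemidef.trace_mul_nonneg {A C : Matrix (Fin k) (Fin k) ℝ}
    (hA : A.PosSemidef) (hC : C.PosSemidef) : 0 ≤ (A * C).trace := by
  obtain ⟨B, rfl⟩ := hA.exists_eq_transpose_mul
  rw [Matrix.mul_assoc, trace_mul_comm]
  exact (hC.mul_mul_conjTranspose_same B).trace_nonneg

/-- The tangent inequality for the concave function log det at `A`. It follows from the case `A = 1`
applied to `B * C * Bᴴ`, where `A⁻¹ = Bᴴ * B`. -/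
theorem det_le_det_mul_exp {A C : Matrix (Fin k) (Fin k) ℝ} (hA : A.PosDef)
    (hC : C.PosSemidef) : C.det ≤ A.det * Real.exp ((A⁻¹ * C).trace - k) := by
  obtain ⟨B, hB⟩ := hA.inv.posSemidef.exists_eq_transpose_mul
  have h := det_le_exp_trace_sub (hC.mul_mul_conjTranspose_same B)
  have h1 : (B * C * Bᴴ).trace = (A⁻¹ * C).trace := by
    rw [hB, Matrix.mul_assoc, trace_mul_comm, trace_mul_comm (Bᴴ * B), Matrix.mul_assoc]
  have h2 : (B * C * Bᴴ).det = A.det⁻¹ * C.det := by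
    rw [det_mul, det_mul, mul_assoc, mul_comm, mul_assoc, mul_comm C.det, ← det_mul, ← hB,
      det_nonsing_inv, Ring.inverse_eq_inv']
  rw [h1, h2, inv_mul_le_iff₀ hA.det_pos] at h
  exact h

theorem det_le_det_of_sub_posSemidef {A C : Matrix (Fin k) (Fin k) ℝ} (hA : A.PosDef)
    (hC : C.PosSemidef) (h : (A - C).PosSemidef) : C.det ≤ A.det := by
  have h0 := hA.inv.posSemidef.trace_mul_nonneg h
  rw [Matrix.mul_sub, nonsing_inv_mul _ hA.det_pos.ne'.isUnit, trace_sub, trace_one,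
    Fintype.card_fin] at h0
  refine (det_le_det_mul_exp hA hC).trans (mul_le_of_le_one_right hA.det_pos.le ?_)
  exact Real.exp_le_one_iff.2 (by linarith)

/-- Strict monotonicity of the determinant: the conjugated difference `B * (A - C) * Bᴴ` is positive
semidefinite with trace at most 0, hence zero, and `B` is invertible. -/
theorem eq_of_sub_posSemidef_of_det_le {A C : Matrix (Fin k) (Fin k) ℝ} (hA : A.PosDef)
    (hC : C.PosSemidef) (h : (A - C).PosSemidef) (hd : A.det ≤ C.det) : C = A := by
  obtain ⟨B, hB⟩ := hA.inv.posSemidef.exists_eq_transpose_mul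
  have h0 := h.mul_mul_conjTranspose_same B
  have ht : (B * (A - C) * Bᴴ).trace = k - (A⁻¹ * C).trace := by
    rw [Matrix.mul_assoc, trace_mul_comm, Matrix.mul_assoc, ← hB, Matrix.sub_mul,
      mul_nonsing_inv _ hA.det_pos.ne'.isUnit, trace_sub, trace_one, Fintype.card_fin,
      trace_mul_comm C]
  have h1 := det_le_det_mul_exp hA hC
  have h2 : 1 ≤ Real.exp ((A⁻¹ * C).trace - k) := by
    have := hd.trans h1
    exact le_of_mul_le_mul_left (by simpa using this) hA.det_pos
  rw [Real.one_le_exp_iff] at h2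
  have h3 : B * (A - C) * Bᴴ = 0 :=
    h0.trace_eq_zero_iff.1 (le_antisymm (by rw [ht]; linarith) h0.trace_nonneg)
  have hBd : (B.det) ≠ 0 := by
    intro hB0
    have := hA.inv.det_pos
    rw [hB, det_mul, hB0, mul_zero] at this
    exact lt_irrefl _ this
  have hBu : IsUnit B := (isUnit_iff_isUnit_det B).2 hBd.isUnit
  have hBu' : IsUnit Bᴴ := (isUnit_iff_isUnit_det _).2 (by simpa [det_conjTranspose] using hBd)
  have h4 : B * (A - C) = 0 := hBu'.mul_left_eq_zero.1 h3
  exact (sub_eq_zero.1 (hBu.mul_right_eq_zero.1 h4)).symm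

/-- Each eigenvalue times the other `k - 1`, all at least `c`, is the determinant. -/
theorem trace_le_of_le_qform_of_det_le {C : Matrix (Fin k) (Fin k) ℝ} (hC : C.IsHermitian)
    {c D : ℝ} (hc : 0 < c) (h : ∀ x, c * ‖x‖ ^ 2 ≤ qform C x) (hD : C.det ≤ D) :
    C.trace ≤ k * (D / c ^ (k - 1)) := by
  have h1 : C.det = ∏ i, hC.eigenvalues i := by simpa using hC.det_eq_prod_eigenvalues
  have h2 : C.trace = ∑ i, hC.eigenvalues i := by simpa using hC.trace_eq_sum_eigenvalues
  have hlow : ∀ i, c ≤ hC.eigenvalues i := fun i => by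
    have h3 := h (hC.eigenvectorBasis i)
    rw [hC.eigenvectorBasis.orthonormal.1 i, qform_eq_dotProduct] at h3
    rw [hC.eigenvalues_eq i]
    simpa using h3
  have hup : ∀ i, hC.eigenvalues i ≤ D / c ^ (k - 1) := fun i => by
    rw [le_div_iff₀ (by positivity)]
    refine le_trans ?_ hD
    rw [h1, ← Finset.mul_prod_erase _ _ (Finset.mem_univ i)]
    refine mul_le_mul_of_nonneg_left ?_ (hc.le.trans (hlow i))
    have := Finset.prod_le_prod (s := Finset.univ.erase i) (f := fun _ => c)
      (g := hC.eigenvalues) (fun _ _ => hc.le) (fun j _ => hlow j)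
    simpa [Finset.card_erase_of_mem] using this
  rw [h2]
  refine (Finset.sum_le_sum fun i _ => hup i).trans ?_
  simp

/-- By Cauchy-Schwarz `‖v‖² I - v v'` is positive semidefinite, so its product with `C` has
nonnegative trace. -/
theorem qform_le_trace_mul {C : Matrix (Fin k) (Fin k) ℝ} (hC : C.PosSemidef) (v : Rk k) :
    qform C v ≤ C.trace * ‖v‖ ^ 2 := by
  have hps : ((‖v‖ ^ 2) • (1 : Matrix (Fin k) (Fin k) ℝ) - vecMulVec v v).PosSemidef := by
    refine posSemidef_of_qform_nonneg ?_ fun x => ?_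
    · ext i j
      simp [vecMulVec_apply, mul_comm, one_apply, eq_comm]
    · have h1 : qform ((‖v‖ ^ 2) • (1 : Matrix (Fin k) (Fin k) ℝ)) x = ‖v‖ ^ 2 * ‖x‖ ^ 2 := by
        rw [← qform_one x]
        simp [qform, Finset.mul_sum, mul_assoc]
      rw [qform_sub_left, qform_vecMulVec, h1, ← mul_pow, sub_nonneg, sq_le_sq,
        abs_of_nonneg (by positivity : 0 ≤ ‖v‖ * ‖x‖)]
      exact abs_real_inner_le_norm v x
  have := hps.trace_mul_nonneg hC
  rw [Matrix.sub_mul, trace_sub, trace_vecMulVec_mul, Matrix.smul_mul, Matrix.one_mul, trace_smul,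
    smul_eq_mul] at this
  linarith

/-- The witness is `w = C⁻¹ v`. These identities turn bounds on `C` into bounds on `C⁻¹` without
diagonalising. -/
theorem exists_mulVec_inv {C : Matrix (Fin k) (Fin k) ℝ} (hC : C.PosDef) (v : Rk k) :
    ∃ w : Rk k, qform C⁻¹ v = inner ℝ w v ∧ qform C w = inner ℝ w v ∧
      ∀ s : ℝ, qform C (w - s • v) = inner ℝ w v - 2 * s * ‖v‖ ^ 2 + s ^ 2 * qform C v := by
  have hu : IsUnit C.det := hC.det_pos.ne'.isUnit
  have hCw : C *ᵥ (C⁻¹ *ᵥ v.ofLp) = v.ofLp := by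
    rw [mulVec_mulVec, mul_nonsing_inv _ hu, one_mulVec]
  have hn : ‖v‖ ^ 2 = v.ofLp ⬝ᵥ v.ofLp := by
    rw [← qform_one, qform_eq_dotProduct, one_mulVec]
  have hT : Cᵀ = C := (by simpa using hC.1 : C.IsSymm)
  refine ⟨WithLp.toLp 2 (C⁻¹ *ᵥ v.ofLp), ?_, ?_, fun s => ?_⟩
  · simp [qform_eq_dotProduct, EuclideanSpace.inner_eq_star_dotProduct]
  · simp [qform_eq_dotProduct, EuclideanSpace.inner_eq_star_dotProduct, hCw, dotProduct_comm]
  · have h1 : (C⁻¹ *ᵥ v.ofLp) ⬝ᵥ (C *ᵥ v.ofLp) = v.ofLp ⬝ᵥ v.ofLp := by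
      rw [dotProduct_mulVec, ← mulVec_transpose, hT, hCw]
    simp only [qform_eq_dotProduct, EuclideanSpace.inner_eq_star_dotProduct, WithLp.ofLp_sub,
      WithLp.ofLp_smul, mulVec_sub, mulVec_smul, hCw, star_trivial, sub_dotProduct,
      dotProduct_sub, smul_dotProduct, dotProduct_smul, smul_eq_mul, h1, hn]
    rw [dotProduct_comm (C⁻¹ *ᵥ v.ofLp)]
    ring

theorem qform_inv_le {C : Matrix (Fin k) (Fin k) ℝ} (hC : C.IsHermitian) {c : ℝ} (hc : 0 < c)
    (h : ∀ x, c * ‖x‖ ^ 2 ≤ qform C x) (v : Rk k) : qform C⁻¹ v ≤ ‖v‖ ^ 2 / c := by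
  obtain ⟨w, h1, h2, -⟩ := exists_mulVec_inv (posDef_of_le_qform hC hc h) v
  have h3 := h w
  have h4 := real_inner_le_norm w v
  rw [h1, le_div_iff₀ hc]
  have h5 : c * ‖w‖ ≤ ‖v‖ := by
    rcases (norm_nonneg w).eq_or_lt with h0 | h0
    · simp [← h0]
    · exact le_of_mul_le_mul_left (by nlinarith) h0
  nlinarith [norm_nonneg v, norm_nonneg w]

theorem le_qform_inv {C : Matrix (Fin k) (Fin k) ℝ} (hC : C.PosDef) {M : ℝ} (hM : 0 < M)
    (h : C.trace ≤ M) (v : Rk k) : ‖v‖ ^ 2 / M ≤ qform C⁻¹ v := by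
  obtain ⟨w, h1, -, h3⟩ := exists_mulVec_inv hC v
  -- The choice `s = M⁻¹` minimizes `-2 s + s² M`, the bound left after estimating `qform C v` by `M
  -- ‖v‖²`.
  have h4 := hC.posSemidef.qform_nonneg (w - M⁻¹ • v)
  have h5 : qform C v ≤ M * ‖v‖ ^ 2 := (qform_le_trace_mul hC.posSemidef v).trans
    (mul_le_mul_of_nonneg_right h (by positivity))
  rw [h3, ← h1] at h4
  have h6 : M⁻¹ ^ 2 * qform C v ≤ M⁻¹ * ‖v‖ ^ 2 := by
    calc M⁻¹ ^ 2 * qform C v ≤ M⁻¹ ^ 2 * (M * ‖v‖ ^ 2) := by gcongr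
      _ = M⁻¹ * ‖v‖ ^ 2 := by field_simp
  rw [div_eq_inv_mul]
  linarith

end MatrixFacts

/-! ### Trimmed means and covariances as moments. -/

section Moments

open Matrix

variable {k : ℕ} {μ ν : Measure (Rk k)} {φ ψ : Rk k → ℝ} {γ : ℝ}

/-- A trimming function without the constraint on its mass. -/
structure IsTrimming (μ : Measure (Rk k)) (φ : Rk k → ℝ) : Prop where
  measurable : Measurable φ
  mem_Icc : ∀ x, φ x ∈ Set.Icc (0 : ℝ) 1
  integrable_sq : Integrable (fun x => ‖x‖ ^ 2 * φ x) μ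

theorem mem_trimmingClass : φ ∈ trimmingClass μ γ ↔ IsTrimming μ φ ∧ γ ≤ ∫ x, φ x ∂μ :=
  ⟨fun ⟨h1, h2, h3, h4⟩ => ⟨⟨h1, h2, h4⟩, h3⟩, fun ⟨⟨h1, h2, h4⟩, h3⟩ => ⟨h1, h2, h3, h4⟩⟩

namespace IsTrimming

theorem nonneg (h : IsTrimming μ φ) (x : Rk k) : 0 ≤ φ x := (h.mem_Icc x).1

theorem le_one (h : IsTrimming μ φ) (x : Rk k) : φ x ≤ 1 := (h.mem_Icc x).2

theorem abs_le_one (h : IsTrimming μ φ) (x : Rk k) : |φ x| ≤ 1 :=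
  abs_le.2 ⟨by linarith [h.nonneg x], h.le_one x⟩

theorem integrable [IsFiniteMeasure μ] (h : IsTrimming μ φ) : Integrable φ μ :=
  .of_bound h.measurable.aestronglyMeasurable 1 (ae_of_all _ fun x => by
    simpa using h.abs_le_one x)

theorem integrable_mul [IsFiniteMeasure μ] (h : IsTrimming μ φ) {f : Rk k → ℝ}
    (hf : Measurable f) {K : ℝ} (hK : ∀ x, |f x| ≤ K * (1 + ‖x‖ ^ 2)) :
    Integrable (fun x => f x * φ x) μ := by
  refine Integrable.mono' ((h.integrable.add h.integrable_sq).const_mul K)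
    (hf.mul h.measurable).aestronglyMeasurable (ae_of_all _ fun x => ?_)
  have h1 := mul_le_mul_of_nonneg_right (hK x) (h.nonneg x)
  rw [Real.norm_eq_abs, abs_mul, abs_of_nonneg (h.nonneg x)]
  simp only [Pi.add_apply]
  linarith

theorem mono_measure (h : IsTrimming μ φ) (hνμ : ν ≤ μ) : IsTrimming ν φ :=
  ⟨h.measurable, h.mem_Icc, h.integrable_sq.mono_measure hνμ⟩

end IsTrimming

theorem abs_apply_le (x : Rk k) (i : Fin k) : |x i| ≤ ‖x‖ := by
  simpa using PiLp.norm_apply_le x i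

theorem abs_sub_apply_le (x t : Rk k) (i : Fin k) :
    |(x - t) i| ≤ (1 + ‖t‖) * (1 + ‖x‖ ^ 2) := by
  have h1 := abs_apply_le (x - t) i
  have h2 := norm_sub_le x t
  nlinarith [sq_nonneg (‖x‖ - 1), norm_nonneg t, norm_nonneg x,
    mul_nonneg (norm_nonneg t) (sq_nonneg ‖x‖)]

theorem abs_sub_mul_sub_le (x t : Rk k) (i j : Fin k) :
    |(x - t) i * (x - t) j| ≤ (2 + 2 * ‖t‖ ^ 2) * (1 + ‖x‖ ^ 2) := by
  have h1 := abs_apply_le (x - t) i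
  have h1' := abs_apply_le (x - t) j
  have h2 := norm_sub_le x t
  have h3 : |(x - t) i * (x - t) j| ≤ (‖x‖ + ‖t‖) ^ 2 := by
    rw [abs_mul, sq]
    exact mul_le_mul (h1.trans h2) (h1'.trans h2) (abs_nonneg _) (by positivity)
  nlinarith [sq_nonneg (‖x‖ - ‖t‖), mul_nonneg (sq_nonneg ‖t‖) (sq_nonneg ‖x‖), sq_nonneg ‖x‖]

@[fun_prop]
theorem measurable_apply_rk (i : Fin k) : Measurable (fun x : Rk k => x i) :=
  (EuclideanSpace.proj (𝕜 := ℝ) i).continuous.measurable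

@[fun_prop]
theorem measurable_sub_apply_rk (t : Rk k) (i : Fin k) : Measurable (fun x : Rk k => (x - t) i) :=
  (measurable_apply_rk i).comp (measurable_id.sub_const t)

variable [IsFiniteMeasure μ] [IsFiniteMeasure ν]

theorem IsTrimming.integrable_smul_id (h : IsTrimming μ φ) :
    Integrable (fun x => φ x • x) μ := by
  have h1 : Integrable (fun x => ‖x‖ * φ x) μ :=
    h.integrable_mul measurable_norm (K := 1) fun x => by
      rw [abs_norm]; nlinarith [sq_nonneg (‖x‖ - 1), norm_nonneg x]
  refine Integrable.mono' h1
    (h.measurable.aestronglyMeasurable.smul measurable_id.aestronglyMeasurable)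
    (ae_of_all _ fun x => ?_)
  rw [norm_smul, Real.norm_eq_abs, abs_of_nonneg (h.nonneg x), mul_comm]

theorem IsTrimming.trimmedMean_apply (h : IsTrimming μ φ) (i : Fin k) :
    trimmedMean μ φ i = (∫ x, φ x ∂μ)⁻¹ * ∫ x, x i * φ x ∂μ := by
  have := (EuclideanSpace.proj (𝕜 := ℝ) i).integral_comp_comm h.integrable_smul_id
  simp only [PiLp.proj_apply, PiLp.smul_apply, smul_eq_mul] at this
  simp only [trimmedMean, PiLp.smul_apply, smul_eq_mul, ← this, mul_comm]

theorem IsTrimming.integrable_sub_mul (h : IsTrimming μ φ) (t : Rk k) (i : Fin k) :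
    Integrable (fun x => (x - t) i * φ x) μ :=
  h.integrable_mul (by fun_prop) fun x => abs_sub_apply_le x t i

theorem IsTrimming.integrable_apply_mul (h : IsTrimming μ φ) (i : Fin k) :
    Integrable (fun x => x i * φ x) μ := by
  simpa using h.integrable_sub_mul 0 i

theorem IsTrimming.integrable_sub_mul_sub_mul (h : IsTrimming μ φ) (t : Rk k) (i j : Fin k) :
    Integrable (fun x => (x - t) i * (x - t) j * φ x) μ :=
  h.integrable_mul (by fun_prop) fun x => abs_sub_mul_sub_le x t i j

theorem IsTrimming.integrable_qform_mul (h : IsTrimming μ φ) (W : Matrix (Fin k) (Fin k) ℝ)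
    (t : Rk k) : Integrable (fun x => qform W (x - t) * φ x) μ := by
  simp only [qform, Finset.sum_mul, mul_assoc]
  refine integrable_finsetSum _ fun i _ => integrable_finsetSum _ fun j _ => ?_
  simpa only [mul_assoc] using (h.integrable_sub_mul_sub_mul t i j).const_mul (W i j)

theorem IsTrimming.integral_sub_mean_mul (h : IsTrimming μ φ) (hm : ∫ x, φ x ∂μ ≠ 0)
    (i : Fin k) : ∫ x, (x - trimmedMean μ φ) i * φ x ∂μ = 0 := by
  simp only [PiLp.sub_apply, sub_mul]
  rw [integral_sub (h.integrable_apply_mul i) (h.integrable.const_mul _), integral_const_mul,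
    h.trimmedMean_apply]
  field_simp
  ring

/-- Parallel-axis identity: the cross terms vanish because deviations from the trimmed mean
integrate to zero. -/
theorem IsTrimming.integral_sub_mul_sub_mul (h : IsTrimming μ φ) (hm : ∫ x, φ x ∂μ ≠ 0)
    (t : Rk k) (i j : Fin k) :
    ∫ x, (x - t) i * (x - t) j * φ x ∂μ = (∫ x, φ x ∂μ) *
      (trimmedCov μ φ i j + (trimmedMean μ φ - t) i * (trimmedMean μ φ - t) j) := by
  set T := trimmedMean μ φ with hT
  have hC : (∫ x, φ x ∂μ) * trimmedCov μ φ i j = ∫ x, (x - T) i * (x - T) j * φ x ∂μ := by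
    simp only [trimmedCov, of_apply, ← hT]
    field_simp
  have h1 : ∀ x, (x - t) i * (x - t) j * φ x = (x - T) i * (x - T) j * φ x +
      (T - t) i * ((x - T) j * φ x) + (T - t) j * ((x - T) i * φ x) +
      (T - t) i * (T - t) j * φ x := fun x => by
    simp only [PiLp.sub_apply]; ring
  have i1 := h.integrable_sub_mul_sub_mul T i j
  have i2 := (h.integrable_sub_mul T j).const_mul ((T - t) i)
  have i3 := (h.integrable_sub_mul T i).const_mul ((T - t) j)
  have i4 := h.integrable.const_mul ((T - t) i * (T - t) j)
  simp only [h1]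
  rw [integral_add, integral_add, integral_add,
    integral_const_mul, integral_const_mul, integral_const_mul, h.integral_sub_mean_mul hm,
    h.integral_sub_mean_mul hm, ← hC]
  · ring
  exacts [i1, i2, i1.add i2, i3, (i1.add i2).add i3, i4]

theorem isHermitian_trimmedCov (μ : Measure (Rk k)) (φ : Rk k → ℝ) :
    (trimmedCov μ φ).IsHermitian := by
  ext i j
  simp only [conjTranspose_apply, star_trivial, trimmedCov, of_apply]
  simp only [mul_comm ((_ : Rk k).ofLp j)]

/-- With `W` equal to `v v'`, the identity or an inverse covariance, this yields directional
variances, the trace and the average Mahalanobis distance. -/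
theorem IsTrimming.integral_qform_mul (h : IsTrimming μ φ) (hm : ∫ x, φ x ∂μ ≠ 0)
    (W : Matrix (Fin k) (Fin k) ℝ) (t : Rk k) :
    ∫ x, qform W (x - t) * φ x ∂μ = (∫ x, φ x ∂μ) *
      ((W * trimmedCov μ φ).trace + qform W (trimmedMean μ φ - t)) := by
  have h0 : ∀ i j, Integrable (fun x => W i j * ((x - t) i * (x - t) j) * φ x) μ := fun i j => by
    simpa only [mul_assoc] using (h.integrable_sub_mul_sub_mul t i j).const_mul (W i j)
  have hs : ∀ i j, trimmedCov μ φ j i = trimmedCov μ φ i j := fun i j => by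
    simpa using (isHermitian_trimmedCov μ φ).apply i j
  simp only [qform, Finset.sum_mul]
  rw [integral_finsetSum _ fun i _ => integrable_finsetSum _ fun j _ => h0 i j]
  simp only [trace, diag_apply, mul_apply, ← Finset.sum_add_distrib, Finset.mul_sum]
  refine Finset.sum_congr rfl fun i _ => ?_
  rw [integral_finsetSum _ fun j _ => h0 i j]
  refine Finset.sum_congr rfl fun j _ => ?_
  simp only [mul_assoc (W i j)]
  rw [integral_const_mul, h.integral_sub_mul_sub_mul hm t i j, hs]
  ring

theorem IsTrimming.integral_inner_sq_mul (h : IsTrimming μ φ) (hm : ∫ x, φ x ∂μ ≠ 0)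
    (v t : Rk k) :
    ∫ x, (inner ℝ v (x - t)) ^ 2 * φ x ∂μ = (∫ x, φ x ∂μ) *
      (qform (trimmedCov μ φ) v + (inner ℝ v (trimmedMean μ φ - t)) ^ 2) := by
  simpa only [qform_vecMulVec, trace_vecMulVec_mul] using
    h.integral_qform_mul hm (vecMulVec v v) t

theorem IsTrimming.integral_norm_sub_sq_mul (h : IsTrimming μ φ) (hm : ∫ x, φ x ∂μ ≠ 0)
    (t : Rk k) :
    ∫ x, ‖x - t‖ ^ 2 * φ x ∂μ = (∫ x, φ x ∂μ) *
      ((trimmedCov μ φ).trace + ‖trimmedMean μ φ - t‖ ^ 2) := by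
  simpa only [qform_one, Matrix.one_mul] using h.integral_qform_mul hm 1 t

theorem IsTrimming.posSemidef_trimmedCov (h : IsTrimming μ φ) (hm : 0 < ∫ x, φ x ∂μ) :
    (trimmedCov μ φ).PosSemidef := by
  refine posSemidef_of_qform_nonneg (isHermitian_trimmedCov μ φ) fun v => ?_
  have h1 := h.integral_inner_sq_mul hm.ne' v (trimmedMean μ φ)
  have h2 : 0 ≤ ∫ x, (inner ℝ v (x - trimmedMean μ φ)) ^ 2 * φ x ∂μ :=
    integral_nonneg fun x => mul_nonneg (sq_nonneg _) (h.nonneg x)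
  rw [h1, sub_self, inner_zero_right] at h2
  simpa using nonneg_of_mul_nonneg_right h2 hm

/-- The trimmed moments depend only on the normalised weighted measure. -/
theorem trimmedMean_eq_and_trimmedCov_eq (hφ : IsTrimming μ φ) (hψ : IsTrimming ν ψ) {c : ℝ}
    (hc : c ≠ 0)
    (h : ∀ f : Rk k → ℝ, Measurable f → ∫ x, f x * φ x ∂μ = c * ∫ x, f x * ψ x ∂ν) :
    trimmedMean μ φ = trimmedMean ν ψ ∧ trimmedCov μ φ = trimmedCov ν ψ := by
  have h0 : ∫ x, φ x ∂μ = c * ∫ x, ψ x ∂ν := by simpa using h (fun _ => 1) measurable_const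
  have hT : trimmedMean μ φ = trimmedMean ν ψ := by
    ext i
    rw [hφ.trimmedMean_apply, hψ.trimmedMean_apply, h _ (measurable_apply_rk i), h0, mul_inv,
      mul_mul_mul_comm, inv_mul_cancel₀ hc, one_mul]
  refine ⟨hT, ?_⟩
  ext i j
  simp only [trimmedCov, of_apply, hT]
  rw [h (fun x => (x - trimmedMean ν ψ) i * (x - trimmedMean ν ψ) j) (by fun_prop), h0, mul_inv,
    mul_mul_mul_comm, inv_mul_cancel₀ hc, one_mul]

omit [IsFiniteMeasure μ] [IsFiniteMeasure ν] in
/-- Convergence of the moments of order at most two entails that of the trimmed moments. -/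
theorem tendsto_trimmed_of_tendsto_moments {ι : Type*} {l : Filter ι} {μs : ι → Measure (Rk k)}
    {φs : ι → Rk k → ℝ} [IsFiniteMeasure ν] [∀ i, IsFiniteMeasure (μs i)]
    (hφ : ∀ᶠ i in l, IsTrimming (μs i) (φs i)) (hψ : IsTrimming ν ψ) (hm : ∫ x, ψ x ∂ν ≠ 0)
    (h0 : Tendsto (fun i => ∫ x, φs i x ∂(μs i)) l (𝓝 (∫ x, ψ x ∂ν)))
    (h1 : ∀ a, Tendsto (fun i => ∫ x, x a * φs i x ∂(μs i)) l (𝓝 (∫ x, x a * ψ x ∂ν)))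
    (h2 : ∀ a b, Tendsto (fun i => ∫ x, x a * x b * φs i x ∂(μs i)) l
      (𝓝 (∫ x, x a * x b * ψ x ∂ν))) :
    Tendsto (fun i => (trimmedMean (μs i) (φs i), trimmedCov (μs i) (φs i))) l
      (𝓝 (trimmedMean ν ψ, trimmedCov ν ψ)) := by
  have hinv := h0.inv₀ hm
  have hT : ∀ a, Tendsto (fun i => trimmedMean (μs i) (φs i) a) l (𝓝 (trimmedMean ν ψ a)) := by
    intro a
    rw [hψ.trimmedMean_apply]
    refine (hinv.mul (h1 a)).congr' ?_
    filter_upwards [hφ] with i hi using (hi.trimmedMean_apply a).symm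
  have key : ∀ {ρ : Measure (Rk k)} {χ : Rk k → ℝ} [IsFiniteMeasure ρ], IsTrimming ρ χ →
      ∫ x, χ x ∂ρ ≠ 0 → ∀ a b, (∫ x, χ x ∂ρ)⁻¹ * ∫ x, x a * x b * χ x ∂ρ -
        trimmedMean ρ χ a * trimmedMean ρ χ b = trimmedCov ρ χ a b := by
    intro ρ χ _ h hm a b
    have := h.integral_sub_mul_sub_mul hm 0 a b
    simp only [sub_zero] at this
    rw [this]
    field_simp
    ring
  refine Tendsto.prodMk_nhds ?_ ?_
  · exact (PiLp.homeomorph 2 (fun _ : Fin k => ℝ)).isInducing.tendsto_nhds_iff.2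
      (tendsto_pi_nhds.2 hT)
  · refine tendsto_pi_nhds.2 fun a => tendsto_pi_nhds.2 fun b => ?_
    rw [← key hψ hm]
    refine ((hinv.mul (h2 a b)).sub ((hT a).mul (hT b))).congr' ?_
    filter_upwards [hφ, h0.eventually_ne hm] with i hi hi' using key hi hi' a b

end Moments

/-! ### Uniform bounds on trimmed moments. -/

section Bounds

open Matrix

variable {k : ℕ} {μ ν : Measure (Rk k)} {φ ψ : Rk k → ℝ} {γ : ℝ}

theorem exists_lt_measureReal_closedBall [IsFiniteMeasure μ] {c : ℝ} (hc : c < μ.real Set.univ) :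
    ∃ ρ : ℝ, 0 < ρ ∧ c < μ.real (Metric.closedBall 0 ρ) := by
  have h1 : Tendsto (fun n : ℕ => μ (Metric.closedBall (0 : Rk k) n)) atTop
      (𝓝 (μ (⋃ n : ℕ, Metric.closedBall (0 : Rk k) n))) :=
    tendsto_measure_iUnion_atTop fun m n hmn => Metric.closedBall_subset_closedBall (by simpa)
  rw [Metric.iUnion_closedBall_nat] at h1
  have h2 := (ENNReal.tendsto_toReal (measure_ne_top μ _)).comp h1
  obtain ⟨n, hn, hn1⟩ := ((h2.eventually_const_lt hc).and (eventually_ge_atTop 1)).exists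
  exact ⟨n, by exact_mod_cast hn1, hn⟩

theorem IsTrimming.of_bounded_support [IsFiniteMeasure μ] (hφ : Measurable φ)
    (h01 : ∀ x, φ x ∈ Set.Icc (0 : ℝ) 1) {ρ : ℝ} (hρ : ∀ x, ρ < ‖x‖ → φ x = 0) :
    IsTrimming μ φ := by
  refine ⟨hφ, h01, .of_bound (by fun_prop) (ρ ^ 2) (ae_of_all _ fun x => ?_)⟩
  rw [Real.norm_eq_abs, abs_of_nonneg (mul_nonneg (sq_nonneg _) (h01 x).1)]
  rcases le_or_gt ‖x‖ ρ with h | h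
  · have : ‖x‖ ^ 2 ≤ ρ ^ 2 := pow_le_pow_left₀ (norm_nonneg x) h 2
    nlinarith [(h01 x).1, (h01 x).2, sq_nonneg ‖x‖]
  · rw [hρ x h, mul_zero]; positivity

theorem IsTrimming.indicator (h : IsTrimming μ φ) {A : Set (Rk k)} (hA : MeasurableSet A) :
    IsTrimming μ (A.indicator φ) := by
  refine ⟨h.measurable.indicator hA, fun x => ?_, ?_⟩
  · by_cases hx : x ∈ A
    · simpa [hx] using h.mem_Icc x
    · simp [hx]
  · refine (h.integrable_sq.indicator hA).congr (ae_of_all _ fun x => ?_)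
    by_cases hx : x ∈ A <;> simp [hx]

theorem isTrimming_indicator_closedBall [IsFiniteMeasure μ] (ρ : ℝ) :
    IsTrimming μ ((Metric.closedBall (0 : Rk k) ρ).indicator 1) := by
  refine .of_bounded_support (ρ := ρ)
    (measurable_one.indicator Metric.isClosed_closedBall.measurableSet) (fun x => ?_) fun x hx => ?_
  · by_cases hx : x ∈ Metric.closedBall (0 : Rk k) ρ
    · rw [Set.indicator_of_mem hx]; simp
    · rw [Set.indicator_of_notMem hx]; simp
  · rw [Set.indicator_of_notMem (by simpa using hx)]

theorem integral_indicator_closedBall (ρ : ℝ) :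
    ∫ x, (Metric.closedBall (0 : Rk k) ρ).indicator 1 x ∂μ =
      μ.real (Metric.closedBall (0 : Rk k) ρ) := by
  rw [integral_indicator_one Metric.isClosed_closedBall.measurableSet]

/-- The second moment about 0 bounds the trace by `ρ ^ 2`. The point is that the resulting bound
does not depend on `μ`, so it bounds minimal determinants along a whole family. -/
theorem det_trimmedCov_indicator_closedBall_le [IsFiniteMeasure μ] {ρ : ℝ}
    (hρ : 0 < μ.real (Metric.closedBall (0 : Rk k) ρ)) :
    (trimmedCov μ ((Metric.closedBall (0 : Rk k) ρ).indicator 1)).det ≤ Real.exp (ρ ^ 2) := by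
  have h := isTrimming_indicator_closedBall (μ := μ) (k := k) ρ
  rw [← integral_indicator_closedBall] at hρ
  refine (det_le_exp_trace_sub (h.posSemidef_trimmedCov hρ)).trans (Real.exp_le_exp.2 ?_)
  have h1 := h.integral_norm_sub_sq_mul hρ.ne' 0
  have h2 : ∫ x, ‖x - 0‖ ^ 2 * (Metric.closedBall (0 : Rk k) ρ).indicator 1 x ∂μ ≤
      ∫ x, ρ ^ 2 * (Metric.closedBall (0 : Rk k) ρ).indicator 1 x ∂μ := by
    refine integral_mono (by simpa using h.integrable_sq) (h.integrable.const_mul _) fun x => ?_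
    by_cases hx : x ∈ Metric.closedBall (0 : Rk k) ρ
    · have : ‖x‖ ≤ ρ := by simpa using hx
      simp only [sub_zero, Set.indicator_of_mem hx, Pi.one_apply, mul_one]
      exact pow_le_pow_left₀ (norm_nonneg x) this 2
    · simp [Set.indicator_of_notMem hx]
  rw [h1, integral_const_mul, mul_comm (ρ ^ 2)] at h2
  have h3 := le_of_mul_le_mul_left h2 hρ
  have : (0 : ℝ) ≤ k := k.cast_nonneg
  nlinarith [sq_nonneg ‖trimmedMean μ ((Metric.closedBall (0 : Rk k) ρ).indicator 1) - 0‖]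

/-- If every hyperplane has mass less than `c`, so do uniformly all slabs of some fixed width. -/
theorem exists_slab_bound [IsFiniteMeasure ν] {c : ℝ} (hc : 0 < c)
    (h : ∀ (a : Rk k) (b : ℝ), a ≠ 0 → ν.real {x | inner ℝ a x = b} < c) :
    ∃ δ > 0, ∃ c' < c, 0 ≤ c' ∧
      ∀ (a : Rk k) (b : ℝ), ‖a‖ = 1 → ν.real {x | |inner ℝ a x - b| ≤ δ} ≤ c' := by
  by_contra! hcon
  have hn : ∀ n : ℕ, ∃ (a : Rk k) (b : ℝ), ‖a‖ = 1 ∧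
      c - c / (n + 1) < ν.real {x | |inner ℝ a x - b| ≤ 1 / ((n : ℝ) + 1)} := fun n => by
    refine hcon _ (by positivity) _ (sub_lt_self _ (by positivity)) (sub_nonneg.2 ?_)
    exact div_le_self hc.le (by simp)
  choose a b ha hab using hn
  -- The offsets `b n` may be unbounded; dividing the pair by `max 1 |b n|` gives sup norm 1, so a
  -- subsequence converges to a nonzero `(α, β)`.
  set s : ℕ → ℝ := fun n => max 1 |b n| with hs
  have hs1 : ∀ n, 1 ≤ s n := fun n => le_max_left _ _
  have hs0 : ∀ n, 0 < s n := fun n => one_pos.trans_le (hs1 n)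
  set p : ℕ → Rk k × ℝ := fun n => ((s n)⁻¹ • a n, (s n)⁻¹ * b n) with hp
  have hpn : ∀ n, ‖p n‖ = 1 := fun n => by
    rw [hp, Prod.norm_def, norm_smul, norm_mul, ha, mul_one, Real.norm_eq_abs, Real.norm_eq_abs,
      abs_of_pos (inv_pos.2 (hs0 n))]
    rcases max_cases 1 |b n| with ⟨h1, h2⟩ | ⟨h1, h2⟩
    · have : s n = 1 := h1
      simp [this, h2]
    · have : s n = |b n| := h1
      rw [this, inv_mul_cancel₀ (by linarith)]
      exact max_eq_right (inv_le_one_of_one_le₀ h2.le)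
  obtain ⟨⟨α, β⟩, -, θ, hθ, hlim⟩ := tendsto_subseq_of_bounded (x := p)
    (Metric.isBounded_closedBall (x := 0) (r := 1)) fun n => by simp [hpn]
  have hnorm : ‖(α, β)‖ = 1 := tendsto_nhds_unique hlim.norm (by simp [hpn])
  have hα : Tendsto (fun n => (p (θ n)).1) atTop (𝓝 α) := (continuous_fst.tendsto _).comp hlim
  have hβ : Tendsto (fun n => (p (θ n)).2) atTop (𝓝 β) := (continuous_snd.tendsto _).comp hlim
  set S : ℕ → Set (Rk k) := fun n =>
    {x | |inner ℝ (a (θ n)) x - b (θ n)| ≤ 1 / ((θ n : ℝ) + 1)} with hS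
  have hSm : ∀ n, MeasurableSet (S n) := fun n =>
    measurableSet_le (by fun_prop) measurable_const
  set U : ℕ → Set (Rk k) := fun N => ⋃ n ≥ N, S n with hU
  have hUm : ∀ N, MeasurableSet (U N) := fun N =>
    .iUnion fun n => .iUnion fun _ => hSm n
  have hUa : Antitone U := fun M N hMN =>
    Set.iUnion_mono fun n => Set.iUnion_mono' fun hn => ⟨le_trans hMN hn, le_rfl⟩
  have hθ0 : Tendsto (fun n => 1 / ((θ n : ℝ) + 1)) atTop (𝓝 0) :=
    tendsto_one_div_add_atTop_nhds_zero_nat.comp hθ.tendsto_atTop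
  -- A point lying in infinitely many of the shrinking slabs lies on the limiting hyperplane.
  have hsub : (⋂ N, U N) ⊆ {x | inner ℝ α x = β} := by
    intro x hx
    have hfreq : ∃ᶠ n in atTop, x ∈ S n := by
      rw [frequently_atTop]
      intro N
      simpa [hU] using Set.mem_iInter.1 hx N
    have ht : Tendsto (fun n => |inner ℝ (p (θ n)).1 x - (p (θ n)).2|) atTop
        (𝓝 |inner ℝ α x - β|) := ((hα.inner tendsto_const_nhds).sub hβ).abs
    have hle : ∃ᶠ n in atTop, |inner ℝ (p (θ n)).1 x - (p (θ n)).2| ≤ 1 / ((θ n : ℝ) + 1) := by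
      refine hfreq.mono fun n hxn => ?_
      simp only [hp, inner_smul_left, RCLike.conj_to_real, ← mul_sub, abs_mul]
      rw [abs_of_pos (inv_pos.2 (hs0 _))]
      exact (mul_le_of_le_one_left (abs_nonneg _) (inv_le_one_of_one_le₀ (hs1 _))).trans hxn
    have h0 : |inner ℝ α x - β| ≤ 0 := by
      by_contra! hpos
      exact hle ((hθ0.eventually_lt ht hpos).mono fun n hn => not_le.2 hn)
    exact sub_eq_zero.1 (abs_nonpos_iff.1 h0)
  have hmeas : c ≤ ν.real (⋂ N, U N) := by
    have h1 := tendsto_measure_iInter_atTop (μ := ν) (fun N => (hUm N).nullMeasurableSet) hUa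
      ⟨0, measure_ne_top _ _⟩
    have h2 : Tendsto (fun N => ν.real (U N)) atTop (𝓝 (ν.real (⋂ N, U N))) :=
      (ENNReal.tendsto_toReal (measure_ne_top _ _)).comp h1
    have h3 : Tendsto (fun n => c - c / ((θ n : ℝ) + 1)) atTop (𝓝 c) := by
      simpa [div_eq_mul_inv] using (hθ0.const_mul c).const_sub c
    refine le_of_tendsto_of_tendsto' h3 h2 fun n => (hab (θ n)).le.trans ?_
    exact measureReal_mono (Set.subset_iUnion₂_of_subset n le_rfl le_rfl) (measure_ne_top _ _)
  have hle := hmeas.trans (measureReal_mono hsub)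
  -- If `α = 0` then `β ≠ 0`, so the limiting set is empty, which contradicts mass at least `c > 0`.
  rcases eq_or_ne α 0 with h0 | h0
  · have hβ0 : β ≠ 0 := by
      rintro rfl
      simp [h0] at hnorm
    have : {x : Rk k | inner ℝ α x = β} = ∅ := by
      ext x
      simp [h0, hβ0.symm]
    rw [this] at hle
    simp at hle
    linarith
  · exact (h α β h0).not_ge hle

theorem mul_integral_le_of_smul_le [IsFiniteMeasure μ] {a : ℝ} (ha : 0 ≤ a)
    (h : ENNReal.ofReal a • ν ≤ μ) {f : Rk k → ℝ} (hf : Integrable f μ) (h0 : ∀ x, 0 ≤ f x) :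
    a * ∫ x, f x ∂ν ≤ ∫ x, f x ∂μ := by
  have := integral_mono_measure h (ae_of_all _ h0) hf
  rwa [integral_smul_measure, ENNReal.toReal_ofReal ha, smul_eq_mul] at this

theorem IsTrimming.of_smul_le (h : IsTrimming μ φ) {a : ℝ} (ha : 0 < a)
    (hle : ENNReal.ofReal a • ν ≤ μ) : IsTrimming ν φ := by
  have := h.mono_measure hle
  refine ⟨h.measurable, h.mem_Icc, ?_⟩
  have h2 := this.integrable_sq
  rwa [integrable_smul_measure (by simpa using ha) ENNReal.ofReal_ne_top] at h2

theorem IsTrimming.integral_le [IsFiniteMeasure μ] (h : IsTrimming μ φ) :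
    ∫ x, φ x ∂μ ≤ μ.real Set.univ := by
  have := integral_mono h.integrable (integrable_const (1 : ℝ)) h.le_one
  simpa using this

theorem qform_smul (C : Matrix (Fin k) (Fin k) ℝ) (s : ℝ) (v : Rk k) :
    qform C (s • v) = s ^ 2 * qform C v := by
  simp only [qform, PiLp.smul_apply, smul_eq_mul, Finset.mul_sum]
  exact Finset.sum_congr rfl fun i _ => Finset.sum_congr rfl fun j _ => by ring

/-- Lower bound for the eigenvalues of the trimmed covariance. -/
theorem IsTrimming.le_qform_trimmedCov [IsFiniteMeasure μ] [IsFiniteMeasure ν]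
    {δ c c' a : ℝ} (hδ : 0 < δ) (ha : 0 < a)
    (hslab : ∀ (v : Rk k) (b : ℝ), ‖v‖ = 1 → ν.real {x | |inner ℝ v x - b| ≤ δ} ≤ c')
    (hμ : μ.real Set.univ ≤ 1) (hle : ENNReal.ofReal a • ν ≤ μ) (h : IsTrimming μ φ)
    (hm : 0 < ∫ x, φ x ∂μ) (hc : c ≤ ∫ x, φ x ∂ν) (v : Rk k) :
    a * δ ^ 2 * (c - c') * ‖v‖ ^ 2 ≤ qform (trimmedCov μ φ) v := by
  have hν := h.of_smul_le ha hle
  have key : ∀ u : Rk k, ‖u‖ = 1 → a * δ ^ 2 * (c - c') ≤ qform (trimmedCov μ φ) u := by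
    intro u hu
    set T := trimmedMean μ φ
    have h1 := h.integral_inner_sq_mul hm.ne' u T
    have hint : Integrable (fun x => (inner ℝ u (x - T)) ^ 2 * φ x) μ := by
      simpa only [qform_vecMulVec] using h.integrable_qform_mul (vecMulVec u u) T
    have hintν : Integrable (fun x => (inner ℝ u (x - T)) ^ 2 * φ x) ν := by
      simpa only [qform_vecMulVec] using hν.integrable_qform_mul (vecMulVec u u) T
    have h2 := mul_integral_le_of_smul_le ha.le hle hint
      fun x => mul_nonneg (sq_nonneg _) (h.nonneg x)
    set S : Set (Rk k) := {x | |inner ℝ u x - inner ℝ u T| ≤ δ} with hS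
    have hSm : MeasurableSet S := measurableSet_le (by fun_prop) measurable_const
    have hSi : Integrable (S.indicator (1 : Rk k → ℝ)) ν := (integrable_const (1 : ℝ)).indicator hSm
    -- The integrands are ordered pointwise: on the slab the left one is at most 0, and off it the
    -- squared deviation exceeds `δ ^ 2`.
    have h3 : ∫ x, δ ^ 2 * (φ x - S.indicator 1 x) ∂ν ≤
        ∫ x, (inner ℝ u (x - T)) ^ 2 * φ x ∂ν := by
      refine integral_mono ((hν.integrable.sub hSi).const_mul _)
        hintν fun x => ?_
      have hx0 := h.nonneg x
      by_cases hx : x ∈ S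
      · have : δ ^ 2 * (φ x - 1) ≤ 0 :=
          mul_nonpos_of_nonneg_of_nonpos (sq_nonneg _) (by linarith [h.le_one x])
        simp only [Set.indicator_of_mem hx, Pi.one_apply]
        exact this.trans (mul_nonneg (sq_nonneg _) hx0)
      · have hx' : δ < |inner ℝ u (x - T)| := by
          rw [inner_sub_right]; simpa [hS] using hx
        simp only [Set.indicator_of_notMem hx, sub_zero]
        refine mul_le_mul_of_nonneg_right ?_ hx0
        rw [← sq_abs (inner ℝ u (x - T))]
        exact pow_le_pow_left₀ hδ.le hx'.le 2
    rw [integral_const_mul, integral_sub hν.integrable hSi,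
      integral_indicator_one hSm] at h3
    have h4 : c - c' ≤ ∫ x, φ x ∂ν - ν.real S := by linarith [hslab u (inner ℝ u T) hu]
    have h5 : a * (δ ^ 2 * (c - c')) ≤ a * (δ ^ 2 * (∫ x, φ x ∂ν - ν.real S)) := by gcongr
    rw [h1, sub_self, inner_zero_right] at h2
    have h6 := mul_le_mul_of_nonneg_left h3 ha.le
    have h7 : (∫ x, φ x ∂μ) * qform (trimmedCov μ φ) u ≤ qform (trimmedCov μ φ) u :=
      mul_le_of_le_one_left ((h.posSemidef_trimmedCov hm).qform_nonneg u) (h.integral_le.trans hμ)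
    have h8 : (∫ x, φ x ∂μ) * (qform (trimmedCov μ φ) u + 0 ^ 2) =
        (∫ x, φ x ∂μ) * qform (trimmedCov μ φ) u := by ring
    linarith
  rcases eq_or_ne v 0 with rfl | hv
  · simp [qform]
  · have hv0 : ‖v‖ ≠ 0 := norm_ne_zero_iff.2 hv
    have h1 := key (‖v‖⁻¹ • v) (by rw [norm_smul, norm_inv, norm_norm, inv_mul_cancel₀ hv0])
    rw [qform_smul] at h1
    have h2 := mul_le_mul_of_nonneg_right h1 (sq_nonneg ‖v‖)
    rwa [mul_right_comm (‖v‖⁻¹ ^ 2), ← mul_pow, inv_mul_cancel₀ hv0, one_pow, one_mul] at h2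

/-- Trimming functions with bounded `det C` have uniformly bounded trimmed moments. -/
theorem exists_uniform_bounds [IsFiniteMeasure ν] {δ c c' a : ℝ} (hδ : 0 < δ) (ha : 0 < a)
    (hc0 : 0 < c) (hcc : c' < c)
    (hslab : ∀ (v : Rk k) (b : ℝ), ‖v‖ = 1 → ν.real {x | |inner ℝ v x - b| ≤ δ} ≤ c') (D : ℝ) :
    ∃ e > 0, ∃ M > 0, ∀ (μ : Measure (Rk k)) [IsFiniteMeasure μ] (φ : Rk k → ℝ),
      μ.real Set.univ ≤ 1 → ENNReal.ofReal a • ν ≤ μ → IsTrimming μ φ → 0 < ∫ x, φ x ∂μ →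
      c ≤ ∫ x, φ x ∂ν → (trimmedCov μ φ).det ≤ D →
      (∀ v, e * ‖v‖ ^ 2 ≤ qform (trimmedCov μ φ) v) ∧ (trimmedCov μ φ).trace ≤ M ∧
        ‖trimmedMean μ φ‖ ≤ M := by
  set e := a * δ ^ 2 * (c - c') with he
  have he0 : 0 < e := by have := sub_pos.2 hcc; positivity
  set K := |k * (D / e ^ (k - 1))| with hK
  obtain ⟨ρ, hρ0, hρ⟩ := exists_lt_measureReal_closedBall (μ := ν)
    (sub_lt_self (ν.real Set.univ) (half_pos hc0))
  -- Here `K` bounds the trace, and the ball of radius `ρ` misses less than `c / 2` of `ν`, so `φ`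
  -- keeps at least `c / 2` inside it. A mean of norm above this constant would lie at distance at
  -- least `y > 1 + 2K/(ac)` from that mass, forcing the trace to be at least `a y² c / 2 > K`.
  refine ⟨e, he0, 1 + K + ρ + 2 * K / (a * c), by positivity, ?_⟩
  intro μ _ φ hμ hle h hm hc hD
  have h1 := h.le_qform_trimmedCov hδ ha hslab hμ hle hm hc
  have h2 : (trimmedCov μ φ).trace ≤ K :=
    (trace_le_of_le_qform_of_det_le (isHermitian_trimmedCov μ φ) he0 h1 hD).trans (le_abs_self _)
  have hKa : 0 ≤ 2 * K / (a * c) := by positivity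
  refine ⟨h1, by linarith, ?_⟩
  by_contra! hT
  set T := trimmedMean μ φ with hTd
  have hν := h.of_smul_le ha hle
  have hps := (h.posSemidef_trimmedCov hm).trace_nonneg
  set y := ‖T‖ - ρ with hy
  have hy1 : 1 + 2 * K / (a * c) < y := by have := abs_nonneg (k * (D / e ^ (k - 1))); linarith
  have h3 := h.integral_norm_sub_sq_mul hm.ne' T
  have hint : Integrable (fun x => ‖x - T‖ ^ 2 * φ x) μ := by
    simpa only [qform_one] using h.integrable_qform_mul 1 T
  have hintν : Integrable (fun x => ‖x - T‖ ^ 2 * φ x) ν := by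
    simpa only [qform_one] using hν.integrable_qform_mul 1 T
  have h4 := mul_integral_le_of_smul_le ha.le hle hint
      fun x => mul_nonneg (sq_nonneg _) (h.nonneg x)
  set S : Set (Rk k) := (Metric.closedBall 0 ρ)ᶜ with hS
  have hSm : MeasurableSet S := Metric.isClosed_closedBall.measurableSet.compl
  have hSi : Integrable (S.indicator (1 : Rk k → ℝ)) ν := (integrable_const (1 : ℝ)).indicator hSm
  have h5 : ∫ x, y ^ 2 * (φ x - S.indicator 1 x) ∂ν ≤ ∫ x, ‖x - T‖ ^ 2 * φ x ∂ν := by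
    refine integral_mono ((hν.integrable.sub hSi).const_mul _)
      hintν fun x => ?_
    have hx0 := h.nonneg x
    by_cases hx : x ∈ S
    · have : y ^ 2 * (φ x - 1) ≤ 0 :=
        mul_nonpos_of_nonneg_of_nonpos (sq_nonneg _) (by linarith [h.le_one x])
      simp only [Set.indicator_of_mem hx, Pi.one_apply]
      exact this.trans (mul_nonneg (sq_nonneg _) hx0)
    · have hx' : ‖x‖ ≤ ρ := by simpa [hS] using hx
      simp only [Set.indicator_of_notMem hx, sub_zero]
      refine mul_le_mul_of_nonneg_right ?_ hx0
      refine pow_le_pow_left₀ (by linarith) ?_ 2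
      have := norm_sub_norm_le T x
      rw [norm_sub_rev]
      linarith
  rw [integral_const_mul, integral_sub hν.integrable hSi,
    integral_indicator_one hSm] at h5
  have h6 : ν.real S ≤ c / 2 := by
    rw [hS, measureReal_compl Metric.isClosed_closedBall.measurableSet]
    linarith
  have h7 : a * (y ^ 2 * (c / 2)) ≤ (trimmedCov μ φ).trace := by
    have h8 : a * (y ^ 2 * (c / 2)) ≤ a * (y ^ 2 * (∫ x, φ x ∂ν - ν.real S)) := by
      gcongr; linarith
    have h9 := mul_le_mul_of_nonneg_left h5 ha.le
    rw [h3, sub_self, norm_zero] at h4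
    have h10 : (∫ x, φ x ∂μ) * (trimmedCov μ φ).trace ≤ (trimmedCov μ φ).trace :=
      mul_le_of_le_one_left hps (h.integral_le.trans hμ)
    have h11 : (∫ x, φ x ∂μ) * ((trimmedCov μ φ).trace + 0 ^ 2) =
        (∫ x, φ x ∂μ) * (trimmedCov μ φ).trace := by ring
    linarith
  have h12 : y < y ^ 2 := by nlinarith
  have h13 : 2 * K / (a * c) < y ^ 2 := by linarith
  rw [div_lt_iff₀ (by positivity)] at h13
  nlinarith

end Bounds

/-! ### First-order optimality and bounded support of minimizers. -/

section Minimizers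

open Matrix

variable {k : ℕ} {μ ν : Measure (Rk k)} {φ ψ : Rk k → ℝ} {γ : ℝ}

theorem IsMinimizingTrimming.isTrimming (h : IsMinimizingTrimming μ γ φ) : IsTrimming μ φ :=
  (mem_trimmingClass.1 h.1).1

theorem IsMinimizingTrimming.le_integral (h : IsMinimizingTrimming μ γ φ) :
    γ ≤ ∫ x, φ x ∂μ := (mem_trimmingClass.1 h.1).2

/-- A minimizing trimming function may be rescaled so as to have mass exactly `γ`. -/
theorem IsMinimizingTrimming.exists_integral_eq [IsFiniteMeasure μ]
    (h : IsMinimizingTrimming μ γ φ) (hγ : 0 < γ) :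
    ∃ ψ, IsMinimizingTrimming μ γ ψ ∧ ∫ x, ψ x ∂μ = γ ∧
      trimmedMean μ ψ = trimmedMean μ φ ∧ trimmedCov μ ψ = trimmedCov μ φ := by
  have hφ := h.isTrimming
  have hm := hγ.trans_le h.le_integral
  set c := γ / ∫ x, φ x ∂μ with hc
  have hc0 : 0 < c := div_pos hγ hm
  have hc1 : c ≤ 1 := (div_le_one hm).2 h.le_integral
  have hψ : IsTrimming μ (fun x => c * φ x) := by
    refine ⟨hφ.measurable.const_mul c, fun x => ⟨mul_nonneg hc0.le (hφ.nonneg x), ?_⟩, ?_⟩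
    · exact mul_le_one₀ hc1 (hφ.nonneg x) (hφ.le_one x)
    · refine (hφ.integrable_sq.const_mul c).congr (ae_of_all _ fun x => ?_)
      simp only
      ring
  have hint : ∫ x, c * φ x ∂μ = γ := by
    rw [integral_const_mul, hc, div_mul_cancel₀ _ hm.ne']
  obtain ⟨h1, h2⟩ := trimmedMean_eq_and_trimmedCov_eq hψ hφ hc0.ne' fun f _ => by
    rw [← integral_const_mul]
    exact integral_congr_ae (ae_of_all _ fun x => by simp only; ring)
  refine ⟨_, ⟨mem_trimmingClass.2 ⟨hψ, hint.ge⟩, ?_⟩, hint, h1, h2⟩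
  rw [h2]
  exact h.2

/-- Exchange argument: a minimizing trimming function of mass `γ` vanishes where the Mahalanobis
distance exceeds its values on a bounded set of mass more than `γ`. -/
theorem IsMinimizingTrimming.ae_eq_zero_of_lt [IsFiniteMeasure μ]
    (h : IsMinimizingTrimming μ γ φ) (hγ : 0 < γ) (hm : ∫ x, φ x ∂μ = γ)
    (hC : (trimmedCov μ φ).PosDef) {A B : Set (Rk k)} (hA : MeasurableSet A)
    (hB : MeasurableSet B) {dA dB ρ : ℝ} (hd : dB < dA) (hBρ : B ⊆ Metric.closedBall 0 ρ)
    (hdA : ∀ x ∈ A, dA ≤ qform (trimmedCov μ φ)⁻¹ (x - trimmedMean μ φ))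
    (hdB : ∀ x ∈ B, qform (trimmedCov μ φ)⁻¹ (x - trimmedMean μ φ) ≤ dB)
    (hγB : γ < μ.real B) : ∀ᵐ x ∂μ, x ∈ A → φ x = 0 := by
  have hφ := h.isTrimming
  set C := trimmedCov μ φ with hCd
  set T := trimmedMean μ φ with hTd
  set f : Rk k → ℝ := fun x => qform C⁻¹ (x - T) with hf
  have hφA : IsTrimming μ (A.indicator φ) := hφ.indicator hA
  have hφB : IsTrimming μ (B.indicator fun x => 1 - φ x) := by
    refine .of_bounded_support (ρ := ρ) ((measurable_const.sub hφ.measurable).indicator hB)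
      (fun x => ?_) fun x hx => ?_
    · by_cases hx : x ∈ B
      · rw [Set.indicator_of_mem hx]
        exact ⟨by linarith [hφ.le_one x], by linarith [hφ.nonneg x]⟩
      · rw [Set.indicator_of_notMem hx]; simp
    · exact Set.indicator_of_notMem (fun hxB => (not_le.2 hx) (by simpa using hBρ hxB)) _
  -- `q` is the mass that can be removed from `A`, and `p` the room left in `B`; `p > 0` because `B`
  -- has mass more than `γ`.
  set q := ∫ x, A.indicator φ x ∂μ with hq
  set p := ∫ x, B.indicator (fun x => 1 - φ x) x ∂μ with hp
  have hp0 : 0 < p := by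
    have h1 : ∫ x in B, φ x ∂μ ≤ γ :=
      hm ▸ setIntegral_le_integral hφ.integrable (ae_of_all _ hφ.nonneg)
    rw [hp, integral_indicator hB, integral_sub (integrable_const _) hφ.integrable.integrableOn]
    simp only [integral_const, smul_eq_mul, mul_one, measureReal_restrict_apply_univ]
    linarith
  have hq0 : 0 ≤ q := integral_nonneg hφA.nonneg
  rcases hq0.eq_or_lt with hq1 | hq1
  · have := (integral_eq_zero_iff_of_nonneg hφA.nonneg hφA.integrable).1 hq1.symm
    filter_upwards [this] with x hx hxA
    simpa [Set.indicator_of_mem hxA] using hx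
  exfalso
  -- Fractions in `(0, 1]` with `α q = s p`, so that the exchange preserves total mass.
  set α := p / (p + q) with hα
  set s := q / (p + q) with hs
  have hα0 : 0 < α := by positivity
  have hs0 : 0 < s := by positivity
  have hα1 : α ≤ 1 := (div_le_one (by positivity)).2 (by linarith)
  have hs1 : s ≤ 1 := (div_le_one (by positivity)).2 (by linarith)
  have hαs : α * q = s * p := by rw [hα, hs]; ring
  set ψ : Rk k → ℝ := fun x =>
    φ x - α * A.indicator φ x + s * B.indicator (fun x => 1 - φ x) x with hψd
  have hmul : ∀ g : Rk k → ℝ, ∀ x, g x * ψ x = g x * φ x - α * (g x * A.indicator φ x) +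
      s * (g x * B.indicator (fun x => 1 - φ x) x) := fun g x => by simp only [hψd]; ring
  have hint : ∀ g : Rk k → ℝ, Integrable (fun x => g x * φ x) μ →
      Integrable (fun x => g x * A.indicator φ x) μ →
      Integrable (fun x => g x * B.indicator (fun x => 1 - φ x) x) μ →
      Integrable (fun x => g x * ψ x) μ ∧ ∫ x, g x * ψ x ∂μ = ∫ x, g x * φ x ∂μ -
        α * ∫ x, g x * A.indicator φ x ∂μ +
        s * ∫ x, g x * B.indicator (fun x => 1 - φ x) x ∂μ := by
    intro g g1 g2 g3
    simp only [hmul]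
    refine ⟨(g1.sub (g2.const_mul α)).add (g3.const_mul s), ?_⟩
    rw [integral_add, integral_sub, integral_const_mul, integral_const_mul]
    exacts [g1, g2.const_mul α, g1.sub (g2.const_mul α), g3.const_mul s]
  have hdisj : ∀ x ∈ A, x ∉ B := fun x hxA hxB =>
    absurd ((hdA x hxA).trans (hdB x hxB)) (not_le.2 hd)
  have hψ : IsTrimming μ ψ := by
    refine ⟨(hφ.measurable.sub (hφA.measurable.const_mul α)).add (hφB.measurable.const_mul s),
      fun x => ?_, (hint _ hφ.integrable_sq hφA.integrable_sq hφB.integrable_sq).1⟩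
    have h0 := hφ.nonneg x
    have h1 := hφ.le_one x
    simp only [hψd]
    by_cases hxA : x ∈ A
    · rw [Set.indicator_of_mem hxA, Set.indicator_of_notMem (hdisj x hxA)]
      constructor <;> nlinarith
    · rw [Set.indicator_of_notMem hxA]
      by_cases hxB : x ∈ B
      · rw [Set.indicator_of_mem hxB]
        constructor <;> nlinarith
      · rw [Set.indicator_of_notMem hxB]
        constructor <;> nlinarith
  have hψm : ∫ x, ψ x ∂μ = γ := by
    have := (hint (fun _ => 1) (by simpa using hφ.integrable) (by simpa using hφA.integrable)
      (by simpa using hφB.integrable)).2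
    simp only [one_mul] at this
    rw [this, hm, ← hq, ← hp, hαs]
    ring
  have hfψ := (hint f (hφ.integrable_qform_mul _ _) (hφA.integrable_qform_mul _ _)
    (hφB.integrable_qform_mul _ _)).2
  have hfA : dA * q ≤ ∫ x, f x * A.indicator φ x ∂μ := by
    rw [hq, ← integral_const_mul]
    refine integral_mono (hφA.integrable.const_mul _) (hφA.integrable_qform_mul _ _) fun x => ?_
    by_cases hxA : x ∈ A
    · exact mul_le_mul_of_nonneg_right (hdA x hxA) (hφA.nonneg x)
    · simp [Set.indicator_of_notMem hxA]
  have hfB : ∫ x, f x * B.indicator (fun x => 1 - φ x) x ∂μ ≤ dB * p := by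
    rw [hp, ← integral_const_mul]
    refine integral_mono (hφB.integrable_qform_mul _ _) (hφB.integrable.const_mul _) fun x => ?_
    by_cases hxB : x ∈ B
    · exact mul_le_mul_of_nonneg_right (hdB x hxB) (hφB.nonneg x)
    · simp [Set.indicator_of_notMem hxB]
  have e1 := hφ.integral_qform_mul (by rw [hm]; exact hγ.ne') C⁻¹ T
  have e2 := hψ.integral_qform_mul (by rw [hψm]; exact hγ.ne') C⁻¹ T
  have hz : qform C⁻¹ (T - T) = 0 := by simp [qform]
  rw [← hTd, ← hCd, hz, nonsing_inv_mul _ hC.det_pos.ne'.isUnit, trace_one, Fintype.card_fin, hm,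
    add_zero] at e1
  rw [hψm] at e2
  have hn := hC.inv.posSemidef.qform_nonneg (trimmedMean μ ψ - T)
  -- The average of `f` under `φ` is `tr (C⁻¹ C) = k`. The exchange lowers it strictly, and
  -- recentring at the mean of `ψ` can only lower it further.
  have htr : (C⁻¹ * trimmedCov μ ψ).trace < k := by
    have h1 : γ * (C⁻¹ * trimmedCov μ ψ).trace ≤ ∫ x, f x * ψ x ∂μ := by
      rw [e2]; nlinarith
    have h2 : α * (dA * q) ≤ α * ∫ x, f x * A.indicator φ x ∂μ := by gcongr
    have h3 : s * ∫ x, f x * B.indicator (fun x => 1 - φ x) x ∂μ ≤ s * (dB * p) := by gcongr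
    have h4 : s * (dB * p) < α * (dA * q) := by
      have : 0 < (α * q) * (dA - dB) := mul_pos (by positivity) (sub_pos.2 hd)
      have h5 : s * (dB * p) = α * q * dB := by rw [hαs]; ring
      linarith
    refine lt_of_mul_lt_mul_left (a := γ) ?_ hγ.le
    rw [hfψ, e1] at h1
    linarith
  have hdet := det_le_det_mul_exp hC (hψ.posSemidef_trimmedCov (by rw [hψm]; exact hγ))
  have hmin := h.2 ψ (mem_trimmingClass.2 ⟨hψ, hψm.ge⟩)
  have hexp : Real.exp ((C⁻¹ * trimmedCov μ ψ).trace - k) < 1 :=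
    Real.exp_lt_one_iff.2 (by linarith)
  have := mul_lt_mul_of_pos_left hexp hC.det_pos
  linarith

/-- A minimizing trimming function vanishes outside a ball determined by bounds on its moments. -/
theorem IsMinimizingTrimming.ae_eq_zero_of_bounds [IsFiniteMeasure μ]
    (h : IsMinimizingTrimming μ γ φ) (hγ : 0 < γ) (hm : ∫ x, φ x ∂μ = γ) {e M ρ : ℝ}
    (he : 0 < e) (hM : 0 < M) (hρ : 0 < ρ)
    (hlow : ∀ v, e * ‖v‖ ^ 2 ≤ qform (trimmedCov μ φ) v) (htr : (trimmedCov μ φ).trace ≤ M)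
    (hT : ‖trimmedMean μ φ‖ ≤ M) (hγρ : γ < μ.real (Metric.closedBall 0 ρ)) :
    ∀ᵐ x ∂μ, M + 1 + M * ((ρ + M) ^ 2 / e) < ‖x‖ → φ x = 0 := by
  have hherm := isHermitian_trimmedCov μ φ
  have hC := posDef_of_le_qform hherm he hlow
  -- Squared Mahalanobis distances are at most `(ρ + M)² / e = Z / M` on the ball of radius `ρ`, and
  -- at least `(1 + Z)² / M` once `‖x‖ > M + 1 + Z`.
  set Z := M * ((ρ + M) ^ 2 / e) with hZ
  have hZ0 : 0 < Z := by positivity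
  refine h.ae_eq_zero_of_lt hγ hm hC (A := {x | M + 1 + Z < ‖x‖})
    (measurableSet_lt measurable_const measurable_norm)
    Metric.isClosed_closedBall.measurableSet (dA := (1 + Z) ^ 2 / M) (dB := (ρ + M) ^ 2 / e)
    (ρ := ρ) ?_ le_rfl (fun x hx => ?_) (fun x hx => ?_) hγρ
  · rw [lt_div_iff₀ hM]
    nlinarith
  · refine le_trans ?_ (le_qform_inv hC hM htr _)
    have h1 := norm_sub_norm_le x (trimmedMean μ φ)
    have h2 : M + 1 + Z < ‖x‖ := hx
    gcongr
    linarith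
  · refine (qform_inv_le hherm he hlow _).trans ?_
    have h1 := norm_sub_le x (trimmedMean μ φ)
    have h2 : ‖x‖ ≤ ρ := by simpa using hx
    gcongr
    linarith

end Minimizers

/-! ### Weak limits of trimming functions along locally convergent measures. -/

section Limits

open Matrix

variable {k : ℕ} {μ ν : Measure (Rk k)} {φ ψ : Rk k → ℝ} {γ : ℝ} {ι : Type*}

/-- Trimming functions are weakly compact. -/
theorem exists_weak_limit [IsFiniteMeasure ν] (l : Ultrafilter ι) {φs : ι → Rk k → ℝ}
    (hm : ∀ i, Measurable (φs i)) (h01 : ∀ i x, φs i x ∈ Set.Icc (0 : ℝ) 1) :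
    ∃ φ : Rk k → ℝ, Measurable φ ∧ (∀ x, φ x ∈ Set.Icc (0 : ℝ) 1) ∧
      ∀ (f : Rk k → ℝ) (K : ℝ), Measurable f → (∀ x, |f x| ≤ K) →
        Tendsto (fun i => ∫ x, f x * φs i x ∂ν) l (𝓝 (∫ x, f x * φ x ∂ν)) := by
  have hLp : ∀ {f : Rk k → ℝ} {K : ℝ}, Measurable f → (∀ x, |f x| ≤ K) → MemLp f 2 ν :=
    fun hf hK => .of_bound hf.aestronglyMeasurable _ (ae_of_all _ hK)
  have habs : ∀ i x, |φs i x| ≤ 1 := fun i x =>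
    abs_le.2 ⟨by linarith [(h01 i x).1], (h01 i x).2⟩
  -- Bounded functions lie in L² of the finite measure `ν`, so Banach-Alaoglu gives a limit along
  -- the ultrafilter.
  set F : ι → Lp ℝ 2 ν := fun i => (hLp (hm i) (habs i)).toLp (φs i) with hF
  set R : ℝ := ν.real Set.univ ^ ((2 : ENNReal).toReal⁻¹) with hR
  have hFn : ∀ i, ‖F i‖ ≤ R * 1 := fun i => by
    refine Lp.norm_le_of_ae_bound zero_le_one ?_
    filter_upwards [(hLp (hm i) (habs i)).coeFn_toLp] with x hx
    rw [hx]
    exact habs i x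
  have hmem : ∀ i, StrongDual.toWeakDual (InnerProductSpace.toDual ℝ (Lp ℝ 2 ν) (F i)) ∈
      WeakDual.toStrongDual ⁻¹' Metric.closedBall (0 : StrongDual ℝ (Lp ℝ 2 ν)) (R * 1) := fun i => by
    simpa using hFn i
  obtain ⟨L, -, hL⟩ := (WeakDual.isCompact_closedBall (0 : StrongDual ℝ (Lp ℝ 2 ν))
    (R * 1)).ultrafilter_le_nhds (l.map fun i =>
      StrongDual.toWeakDual (InnerProductSpace.toDual ℝ (Lp ℝ 2 ν) (F i)))
    (le_principal_iff.2 (mem_map.2 (univ_mem' hmem)))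
  set G : Lp ℝ 2 ν := (InnerProductSpace.toDual ℝ (Lp ℝ 2 ν)).symm (WeakDual.toStrongDual L) with hG
  have hconv : ∀ (f : Rk k → ℝ) (K : ℝ), Measurable f → (∀ x, |f x| ≤ K) →
      Tendsto (fun i => ∫ x, f x * φs i x ∂ν) l (𝓝 (∫ x, f x * G x ∂ν)) := by
    intro f K hf hK
    set g : Lp ℝ 2 ν := (hLp hf hK).toLp f with hg
    have h1 : Tendsto (fun i => inner ℝ (F i) g) l (𝓝 (inner ℝ G g)) := by
      rw [hG, InnerProductSpace.toDual_symm_apply]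
      exact ((WeakBilin.eval_continuous _ g).tendsto L).comp hL
    have h2 : ∀ (H : Lp ℝ 2 ν), inner ℝ H g = ∫ x, f x * H x ∂ν := fun H => by
      rw [L2.inner_def]
      refine integral_congr_ae ?_
      filter_upwards [(hLp hf hK).coeFn_toLp] with x hx
      rw [hg, hx]
      simp
    rw [h2] at h1
    refine h1.congr fun i => ?_
    rw [h2]
    refine integral_congr_ae ?_
    filter_upwards [(hLp (hm i) (habs i)).coeFn_toLp] with x hx
    rw [hF, hx]
  have hGi : Integrable G ν := (Lp.memLp G).integrable (by norm_num)
  have hset : ∀ s, MeasurableSet s →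
      Tendsto (fun i => ∫ x in s, φs i x ∂ν) l (𝓝 (∫ x in s, G x ∂ν)) := fun s hs => by
    have h1 := hconv (s.indicator 1) 1 (measurable_one.indicator hs) fun x => by
      by_cases hx : x ∈ s <;> simp [hx]
    have h2 : ∀ u : Rk k → ℝ, ∫ x, s.indicator 1 x * u x ∂ν = ∫ x in s, u x ∂ν := fun u => by
      rw [← integral_indicator hs]
      refine integral_congr_ae (ae_of_all _ fun x => ?_)
      by_cases hx : x ∈ s <;> simp [hx]
    simpa only [h2] using h1
  have hφi : ∀ i, Integrable (φs i) ν := fun i =>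
    .of_bound (hm i).aestronglyMeasurable 1 (ae_of_all _ fun x => habs i x)
  have hG0 : 0 ≤ᵐ[ν] G := by
    refine ae_nonneg_of_forall_setIntegral_nonneg hGi fun s hs _ => ?_
    exact ge_of_tendsto' (hset s hs) fun i => setIntegral_nonneg hs fun x _ => (h01 i x).1
  have hG1 : G ≤ᵐ[ν] fun _ => 1 := by
    refine ae_le_of_forall_setIntegral_le hGi (integrable_const _) fun s hs _ => ?_
    exact le_of_tendsto' (hset s hs) fun i => setIntegral_mono (hφi i).integrableOn
      (integrable_const _).integrableOn fun x => (h01 i x).2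
  -- Clipping makes the bounds hold at every point and alters `G` only on a null set.
  refine ⟨fun x => max 0 (min 1 (G x)), measurable_const.max
    (measurable_const.min (Lp.stronglyMeasurable G).measurable),
    fun x => ⟨le_max_left _ _, max_le zero_le_one (min_le_left _ _)⟩, fun f K hf hK => ?_⟩
  have : ∫ x, f x * max 0 (min 1 (G x)) ∂ν = ∫ x, f x * G x ∂ν := by
    refine integral_congr_ae ?_
    filter_upwards [hG0, hG1] with x hx0 hx1
    rw [min_eq_right hx1, max_eq_right (show (0 : ℝ) ≤ G x from hx0)]
  rw [this]
  exact hconv f K hf hK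

/-- Convergence in total variation on bounded sets. -/
def LocallyTendsto (l : Filter ι) (μs : ι → Measure (Rk k)) (ν : Measure (Rk k)) : Prop :=
  ∀ ρ : ℝ, ∀ e > 0, ∀ᶠ i in l, ∀ f : Rk k → ℝ, Measurable f → (∀ x, |f x| ≤ 1) →
    (∀ x, ρ < ‖x‖ → f x = 0) → |∫ x, f x ∂(μs i) - ∫ x, f x ∂ν| ≤ e

theorem LocallyTendsto.mono {l l' : Filter ι} {μs : ι → Measure (Rk k)}
    (h : LocallyTendsto l μs ν) (hl : l' ≤ l) : LocallyTendsto l' μs ν :=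
  fun ρ e he => hl (h ρ e he)

theorem LocallyTendsto.comp {ι' : Type*} {l : Filter ι} {l' : Filter ι'}
    {μs : ι → Measure (Rk k)} (h : LocallyTendsto l μs ν) {u : ι' → ι} (hu : Tendsto u l' l) :
    LocallyTendsto l' (μs ∘ u) ν :=
  fun ρ e he => hu.eventually (h ρ e he)

theorem locallyTendsto_const (l : Filter ι) (ν : Measure (Rk k)) :
    LocallyTendsto l (fun _ => ν) ν :=
  fun _ _ he => Eventually.of_forall fun _ _ _ _ _ => by simpa using he.le

/-- The integrands may vary with `i` because `LocallyTendsto` is uniform in the test function; this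
is what allows products with the varying `φs i`. -/
theorem LocallyTendsto.tendsto_sub {l : Filter ι} {μs : ι → Measure (Rk k)}
    (h : LocallyTendsto l μs ν) {f : ι → Rk k → ℝ} {ρ K : ℝ} (hf : ∀ i, Measurable (f i))
    (hK : ∀ i x, |f i x| ≤ K) (hρ : ∀ i x, ρ < ‖x‖ → f i x = 0) :
    Tendsto (fun i => ∫ x, f i x ∂(μs i) - ∫ x, f i x ∂ν) l (𝓝 0) := by
  have hK1 : 0 < |K| + 1 := by positivity
  rw [Metric.tendsto_nhds]
  intro e he
  filter_upwards [h ρ (e / (2 * (|K| + 1))) (by positivity)] with i hi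
  have h1 := hi (fun x => (|K| + 1)⁻¹ * f i x) ((hf i).const_mul _) (fun x => ?_) fun x hx => by
    rw [hρ i x hx, mul_zero]
  · rw [integral_const_mul, integral_const_mul, ← mul_sub, abs_mul, abs_of_pos (inv_pos.2 hK1),
      inv_mul_le_iff₀ hK1] at h1
    rw [dist_zero_right, Real.norm_eq_abs]
    refine h1.trans_lt ?_
    field_simp
    linarith
  · rw [abs_mul, abs_of_pos (inv_pos.2 hK1), inv_mul_le_iff₀ hK1]
    linarith [hK i x, le_abs_self K]

theorem aecover_closedBall_nat (ν : Measure (Rk k)) :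
    AECover ν atTop fun n : ℕ => Metric.closedBall (0 : Rk k) n :=
  aecover_closedBall tendsto_natCast_atTop_atTop

theorem integral_indicator_mul {A : Set (Rk k)} (hA : MeasurableSet A) (f φ : Rk k → ℝ) :
    ∫ x, A.indicator f x * φ x ∂ν = ∫ x in A, f x * φ x ∂ν := by
  rw [← integral_indicator hA]
  refine integral_congr_ae (ae_of_all _ fun x => ?_)
  by_cases hx : x ∈ A <;> simp [hx]

/-- Tail estimate for the integral of a function of linear growth. -/
theorem IsTrimming.abs_integral_sub_le [IsFiniteMeasure μ] (h : IsTrimming μ φ) {K L ρ : ℝ}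
    (hK : ∫ x, ‖x‖ ^ 2 * φ x ∂μ ≤ K) {f : Rk k → ℝ} (hf : Measurable f) (hL : 0 ≤ L)
    (hfL : ∀ x, |f x| ≤ L * (1 + ‖x‖)) (hρ : 1 ≤ ρ) :
    |∫ x, f x * φ x ∂μ - ∫ x, (Metric.closedBall (0 : Rk k) ρ).indicator f x * φ x ∂μ| ≤
      2 * L * K / ρ := by
  have hfi : Integrable (fun x => f x * φ x) μ := h.integrable_mul hf (K := 2 * L) fun x => by
    refine (hfL x).trans ?_
    nlinarith [mul_nonneg hL (sq_nonneg (‖x‖ - 1)), mul_nonneg hL (sq_nonneg ‖x‖)]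
  have hB : MeasurableSet (Metric.closedBall (0 : Rk k) ρ) := Metric.isClosed_closedBall.measurableSet
  rw [integral_indicator_mul hB, ← integral_add_compl hB hfi, add_sub_cancel_left,
    ← integral_indicator hB.compl, ← Real.norm_eq_abs]
  have hρ0 : 0 < ρ := by linarith
  have hle : ∫ x, 2 * L / ρ * (‖x‖ ^ 2 * φ x) ∂μ ≤ 2 * L * K / ρ := by
    rw [integral_const_mul]
    calc 2 * L / ρ * ∫ x, ‖x‖ ^ 2 * φ x ∂μ ≤ 2 * L / ρ * K := by gcongr
      _ = 2 * L * K / ρ := by ring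
  refine (norm_integral_le_of_norm_le (h.integrable_sq.const_mul (2 * L / ρ))
    (ae_of_all _ fun x => ?_)).trans hle
  have h0 := h.nonneg x
  by_cases hx : x ∈ (Metric.closedBall (0 : Rk k) ρ)ᶜ
  · have hx' : ρ < ‖x‖ := by simpa using hx
    rw [Set.indicator_of_mem hx, Real.norm_eq_abs, abs_mul, abs_of_nonneg h0, ← mul_assoc]
    refine mul_le_mul_of_nonneg_right ((hfL x).trans ?_) h0
    have h2 : 1 + ‖x‖ ≤ 2 / ρ * ‖x‖ ^ 2 := by
      rw [div_mul_eq_mul_div, le_div_iff₀ hρ0]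
      nlinarith
    calc L * (1 + ‖x‖) ≤ L * (2 / ρ * ‖x‖ ^ 2) := by gcongr
      _ = 2 * L / ρ * ‖x‖ ^ 2 := by ring
  · rw [Set.indicator_of_notMem hx, norm_zero]
    positivity

/-- Trimming functions with bounded second moments along locally convergent measures have a limit
for which first moments converge and second moments can only drop. -/
theorem exists_limit_trimming {l : Ultrafilter ι} [IsFiniteMeasure ν] {μs : ι → Measure (Rk k)}
    [∀ i, IsFiniteMeasure (μs i)] (hμ : LocallyTendsto l μs ν) {φs : ι → Rk k → ℝ}
    (hφ : ∀ i, IsTrimming (μs i) (φs i)) {K : ℝ}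
    (hK : ∀ᶠ i in (l : Filter ι), ∫ x, ‖x‖ ^ 2 * φs i x ∂(μs i) ≤ K) :
    ∃ φ, IsTrimming ν φ ∧
      (∀ (f : Rk k → ℝ) (L : ℝ), Measurable f → 0 ≤ L → (∀ x, |f x| ≤ L * (1 + ‖x‖)) →
        Tendsto (fun i => ∫ x, f x * φs i x ∂(μs i)) l (𝓝 (∫ x, f x * φ x ∂ν))) ∧
      ∀ (f : Rk k → ℝ) (L s : ℝ), Measurable f → (∀ x, 0 ≤ f x) →
        (∀ x, f x ≤ L * (1 + ‖x‖ ^ 2)) →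
        Tendsto (fun i => ∫ x, f x * φs i x ∂(μs i)) l (𝓝 s) → ∫ x, f x * φ x ∂ν ≤ s := by
  obtain ⟨φ, hφm, hφ01, hweak⟩ := exists_weak_limit (ν := ν) l (fun i => (hφ i).measurable)
    fun i => (hφ i).mem_Icc
  -- On a bounded set, `μs i` is replaced by `ν` up to a vanishing error, and weak convergence under
  -- the fixed `ν` does the rest.
  have hloc : ∀ (f : Rk k → ℝ) (ρ L : ℝ), Measurable f → (∀ x, |f x| ≤ L) →
      (∀ x, ρ < ‖x‖ → f x = 0) →
      Tendsto (fun i => ∫ x, f x * φs i x ∂(μs i)) l (𝓝 (∫ x, f x * φ x ∂ν)) := by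
    intro f ρ L hf hL hρ
    have h1 := hμ.tendsto_sub (f := fun i x => f x * φs i x) (ρ := ρ) (K := L)
      (fun i => hf.mul (hφ i).measurable) (fun i x => ?_) fun i x hx => by rw [hρ x hx, zero_mul]
    · simpa using h1.add (hweak f L hf hL)
    · rw [abs_mul]
      exact (mul_le_of_le_one_right (abs_nonneg _) ((hφ i).abs_le_one x)).trans (hL x)
  have hball : ∀ n : ℕ, MeasurableSet (Metric.closedBall (0 : Rk k) n) := fun n =>
    Metric.isClosed_closedBall.measurableSet
  have hlocball : ∀ (f : Rk k → ℝ) (L : ℝ) (n : ℕ), Measurable f →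
      (∀ x, |f x| ≤ L * (1 + ‖x‖ ^ 2)) →
      Tendsto (fun i => ∫ x, (Metric.closedBall (0 : Rk k) n).indicator f x * φs i x ∂(μs i)) l
        (𝓝 (∫ x, (Metric.closedBall (0 : Rk k) n).indicator f x * φ x ∂ν)) := by
    intro f L n hf hL
    refine hloc _ n (|L| * (1 + (n : ℝ) ^ 2)) (hf.indicator (hball n)) (fun x => ?_) fun x hx => ?_
    · by_cases hx : x ∈ Metric.closedBall (0 : Rk k) n
      · have : ‖x‖ ≤ n := by simpa using hx
        rw [Set.indicator_of_mem hx]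
        refine (hL x).trans ?_
        gcongr
        exact le_abs_self L
      · rw [Set.indicator_of_notMem hx, abs_zero]; positivity
    · exact Set.indicator_of_notMem (by simpa using hx) _
  -- Fatou-type bound: integrals over a ball converge, and what lies outside is nonnegative, so mass
  -- of `f` may escape but not appear.
  have hfatou : ∀ (f : Rk k → ℝ) (L s : ℝ) (n : ℕ), Measurable f → (∀ x, 0 ≤ f x) →
      (∀ x, f x ≤ L * (1 + ‖x‖ ^ 2)) → (∀ e > 0, ∀ᶠ i in (l : Filter ι),
        ∫ x, f x * φs i x ∂(μs i) ≤ s + e) →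
      ∫ x in Metric.closedBall (0 : Rk k) n, f x * φ x ∂ν ≤ s := by
    intro f L s n hf h0 hL hs
    have hL' : ∀ x, |f x| ≤ L * (1 + ‖x‖ ^ 2) := fun x => by rw [abs_of_nonneg (h0 x)]; exact hL x
    have h1 := hlocball f L n hf hL'
    simp only [integral_indicator_mul (hball n)] at h1
    refine le_of_forall_pos_le_add fun e he => le_of_tendsto h1 ?_
    filter_upwards [hs e he] with i hi
    exact (setIntegral_le_integral ((hφ i).integrable_mul hf hL')
      (ae_of_all _ fun x => mul_nonneg (h0 x) ((hφ i).nonneg x))).trans hi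
  have hsq : ∀ n : ℕ, ∫ x in Metric.closedBall (0 : Rk k) n, ‖x‖ ^ 2 * φ x ∂ν ≤ K := fun n =>
    hfatou (fun x => ‖x‖ ^ 2) 1 K n (by fun_prop) (fun x => sq_nonneg _) (fun x => by linarith)
      fun e he => hK.mono fun i hi => by linarith
  have hint : Integrable (fun x => ‖x‖ ^ 2 * φ x) ν := by
    refine (aecover_closedBall_nat ν).integrable_of_integral_bounded_of_nonneg_ae K (fun n => ?_)
      (ae_of_all _ fun x => mul_nonneg (sq_nonneg _) (hφ01 x).1) (Eventually.of_forall hsq)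
    refine Measure.integrableOn_of_bounded (M := (n : ℝ) ^ 2) (measure_ne_top _ _)
      (by fun_prop) ?_
    refine (ae_restrict_mem (hball n)).mono fun x hx => ?_
    have : ‖x‖ ≤ n := by simpa using hx
    rw [norm_mul, norm_pow, norm_norm, Real.norm_eq_abs, abs_of_nonneg (hφ01 x).1]
    exact (mul_le_of_le_one_right (by positivity) (hφ01 x).2).trans (by gcongr)
  have hT : IsTrimming ν φ := ⟨hφm, hφ01, hint⟩
  have hKν : ∫ x, ‖x‖ ^ 2 * φ x ∂ν ≤ K :=
    le_of_tendsto' ((aecover_closedBall_nat ν).integral_tendsto_of_countably_generated hint) hsq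
  refine ⟨φ, hT, fun f L hf hL hfL => ?_, fun f L s hf h0 hL hs => ?_⟩
  · have hK0 : 0 ≤ K := le_trans (integral_nonneg fun x => mul_nonneg (sq_nonneg _) (hφ01 x).1) hKν
    rw [Metric.tendsto_nhds]
    intro e he
    -- The radius makes both tails, at `μs i` and at `ν`, less than `e / 3`; the bounded part
    -- contributes the last third.
    obtain ⟨n, hn⟩ := exists_nat_gt (1 + 2 * L * K / (e / 3))
    have hn1 : (1 : ℝ) ≤ n := by
      have : 0 ≤ 2 * L * K / (e / 3) := by positivity
      linarith
    have htail : 2 * L * K / n < e / 3 := by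
      have h1 : 2 * L * K / (e / 3) < n := by linarith
      rw [div_lt_iff₀ (by positivity)] at h1
      rw [div_lt_iff₀ (by linarith)]
      linarith
    have h1 := hlocball f (2 * L) n hf fun x => by
      refine (hfL x).trans ?_
      nlinarith [mul_nonneg hL (sq_nonneg (‖x‖ - 1)), mul_nonneg hL (sq_nonneg ‖x‖)]
    filter_upwards [hK, Metric.tendsto_nhds.1 h1 (e / 3) (by positivity)] with i hi hi'
    have h2 := (hφ i).abs_integral_sub_le hi hf hL hfL hn1
    have h3 := hT.abs_integral_sub_le hKν hf hL hfL hn1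
    rw [Real.dist_eq, abs_lt] at *
    rw [abs_le] at h2 h3
    constructor <;> linarith [h2.1, h2.2, h3.1, h3.2, hi'.1, hi'.2]
  · have hL' : ∀ x, |f x| ≤ L * (1 + ‖x‖ ^ 2) := fun x => by rw [abs_of_nonneg (h0 x)]; exact hL x
    refine le_of_tendsto' ((aecover_closedBall_nat ν).integral_tendsto_of_countably_generated
      (hT.integrable_mul hf hL')) fun n => hfatou f L s n hf h0 hL fun e he => ?_
    exact hs.eventually_le_const (by linarith)

end Limits

/-! ### Semicontinuity, existence, and uniform control of minimizers. -/

section MCDLimits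

open Matrix

variable {k : ℕ} {μ ν : Measure (Rk k)} {φ ψ : Rk k → ℝ} {γ : ℝ} {ι : Type*}

theorem continuous_qform (v : Rk k) : Continuous fun C : Matrix (Fin k) (Fin k) ℝ => qform C v := by
  unfold qform
  fun_prop

theorem IsTrimming.integral_norm_sq_mul_le [IsFiniteMeasure μ] (h : IsTrimming μ φ)
    (hm : 0 < ∫ x, φ x ∂μ) (hμ : μ.real Set.univ ≤ 1) :
    ∫ x, ‖x‖ ^ 2 * φ x ∂μ ≤ (trimmedCov μ φ).trace + ‖trimmedMean μ φ‖ ^ 2 := by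
  have h1 := h.integral_norm_sub_sq_mul hm.ne' 0
  simp only [sub_zero] at h1
  rw [h1]
  have := (h.posSemidef_trimmedCov hm).trace_nonneg
  exact mul_le_of_le_one_left (by positivity) (h.integral_le.trans hμ)

theorem IsTrimming.abs_trimmedCov_apply_le [IsFiniteMeasure μ] (h : IsTrimming μ φ)
    (hm : 0 < ∫ x, φ x ∂μ) (i j : Fin k) : |trimmedCov μ φ i j| ≤ (trimmedCov μ φ).trace := by
  set T := trimmedMean μ φ with hT
  have h1 := h.integral_sub_mul_sub_mul hm.ne' T i j
  have h2 := h.integral_norm_sub_sq_mul hm.ne' T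
  rw [← hT, sub_self] at h1 h2
  have h3 : |∫ x, (x - T) i * (x - T) j * φ x ∂μ| ≤ ∫ x, ‖x - T‖ ^ 2 * φ x ∂μ := by
    rw [← Real.norm_eq_abs]
    refine norm_integral_le_of_norm_le
      (by simpa only [qform_one] using h.integrable_qform_mul 1 T) (ae_of_all _ fun x => ?_)
    rw [Real.norm_eq_abs, abs_mul, abs_mul, abs_of_nonneg (h.nonneg x), sq]
    exact mul_le_mul_of_nonneg_right (mul_le_mul (abs_apply_le _ i) (abs_apply_le _ j)
      (abs_nonneg _) (norm_nonneg _)) (h.nonneg x)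
  rw [h1, h2, abs_mul, abs_of_pos hm] at h3
  simpa using le_of_mul_le_mul_left h3 hm

theorem exists_subseq_tendsto {x : ℕ → Rk k × Matrix (Fin k) (Fin k) ℝ} {M : ℝ}
    (h : ∀ᶠ n in atTop, ‖(x n).1‖ ≤ M ∧ ∀ i j, |(x n).2 i j| ≤ M) :
    ∃ (s : ℕ → ℕ) (y : Rk k × Matrix (Fin k) (Fin k) ℝ),
      StrictMono s ∧ Tendsto (x ∘ s) atTop (𝓝 y) := by
  -- Matrices are read as functions under the sup norm, in which bounded sequences have convergent
  -- subsequences.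
  let x' : ℕ → Rk k × (Fin k → Fin k → ℝ) := x
  have hx' : ∀ᶠ n in atTop, x' n ∈ Metric.closedBall 0 (max M 0) := by
    filter_upwards [h] with n hn
    rw [mem_closedBall_zero_iff, Prod.norm_def, max_le_iff,
      pi_norm_le_iff_of_nonneg (le_max_right _ _)]
    refine ⟨hn.1.trans (le_max_left _ _), fun i => ?_⟩
    rw [pi_norm_le_iff_of_nonneg (le_max_right _ _)]
    exact fun j => (hn.2 i j).trans (le_max_left _ _)
  obtain ⟨y, -, s, hs, hy⟩ := tendsto_subseq_of_frequently_bounded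
    Metric.isBounded_closedBall hx'.frequently
  exact ⟨s, y, hs, hy⟩

/-- Limit points of trimmed moments along locally convergent measures dominate trimmed moments of
the limiting measure. -/
theorem exists_trimming_of_tendsto {l : Filter ι} [l.NeBot] [IsFiniteMeasure ν]
    {μs : ι → Measure (Rk k)} [∀ i, IsFiniteMeasure (μs i)] (hμ : LocallyTendsto l μs ν)
    (hμ1 : ∀ᶠ i in l, (μs i).real Set.univ ≤ 1) {φs : ι → Rk k → ℝ}
    (hφ : ∀ i, IsTrimming (μs i) (φs i)) (hγ : 0 < γ) (hm : ∀ i, γ ≤ ∫ x, φs i x ∂(μs i))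
    {T : Rk k} {C : Matrix (Fin k) (Fin k) ℝ}
    (hT : Tendsto (fun i => trimmedMean (μs i) (φs i)) l (𝓝 T))
    (hC : Tendsto (fun i => trimmedCov (μs i) (φs i)) l (𝓝 C)) :
    ∃ φ ∈ trimmingClass ν γ, trimmedMean ν φ = T ∧ (C - trimmedCov ν φ).PosSemidef := by
  have hm0 : ∀ i, 0 < ∫ x, φs i x ∂(μs i) := fun i => hγ.trans_le (hm i)
  have hbd : Tendsto (fun i => (trimmedCov (μs i) (φs i)).trace + ‖trimmedMean (μs i) (φs i)‖ ^ 2)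
      l (𝓝 (C.trace + ‖T‖ ^ 2)) :=
    ((continuous_id.matrix_trace.tendsto C).comp hC).add (hT.norm.pow 2)
  have hK : ∀ᶠ i in l, ∫ x, ‖x‖ ^ 2 * φs i x ∂(μs i) ≤ C.trace + ‖T‖ ^ 2 + 1 := by
    filter_upwards [hμ1, hbd.eventually_le_const (lt_add_one _)] with i h1 h2
    exact ((hφ i).integral_norm_sq_mul_le (hm0 i) h1).trans h2
  -- Passing to an ultrafilter loses nothing, as `T` and `C` are limits along all of `l`.
  have hul : (Ultrafilter.of l : Filter ι) ≤ l := Ultrafilter.of_le l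
  obtain ⟨φ, hφν, hlin, hquad⟩ := exists_limit_trimming (hμ.mono hul) hφ (hul hK)
  have hmass : Tendsto (fun i => ∫ x, φs i x ∂(μs i)) (Ultrafilter.of l) (𝓝 (∫ x, φ x ∂ν)) := by
    simpa using hlin (fun _ => 1) 1 measurable_const zero_le_one fun x => by simp
  have hmγ : γ ≤ ∫ x, φ x ∂ν := ge_of_tendsto' hmass hm
  have hm1 : 0 < ∫ x, φ x ∂ν := hγ.trans_le hmγ
  have hT' := hT.mono_left hul
  have hC' := hC.mono_left hul
  have hTφ : trimmedMean ν φ = T := by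
    refine tendsto_nhds_unique ?_ hT'
    refine (PiLp.homeomorph 2 (fun _ : Fin k => ℝ)).isInducing.tendsto_nhds_iff.2
      (tendsto_pi_nhds.2 fun a => ?_)
    have h1 := hlin (fun x => x a) 1 (by fun_prop) zero_le_one fun x => by
      linarith [abs_apply_le x a]
    have h2 := (hmass.inv₀ hm1.ne').mul h1
    rw [← hφν.trimmedMean_apply] at h2
    exact h2.congr fun i => ((hφ i).trimmedMean_apply a).symm
  refine ⟨φ, mem_trimmingClass.2 ⟨hφν, hmγ⟩, hTφ, ?_⟩
  have hherm : C.IsHermitian := by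
    have h1 : Tendsto (fun i => (trimmedCov (μs i) (φs i))ᴴ) l (𝓝 Cᴴ) :=
      ((continuous_id.matrix_conjTranspose).tendsto C).comp hC
    exact tendsto_nhds_unique h1 (hC.congr fun i => (isHermitian_trimmedCov _ _).symm)
  refine posSemidef_of_qform_nonneg (hherm.sub (isHermitian_trimmedCov _ _)) fun v => ?_
  rw [qform_sub_left, sub_nonneg]
  -- Second moments about 0 drop in every direction while mass and mean are preserved in the limit,
  -- so the whole loss falls on the covariance.
  have h1 : Tendsto (fun i => ∫ x, (inner ℝ v x) ^ 2 * φs i x ∂(μs i)) (Ultrafilter.of l)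
      (𝓝 ((∫ x, φ x ∂ν) * (qform C v + (inner ℝ v T) ^ 2))) := by
    refine (hmass.mul ((((continuous_qform v).tendsto C).comp hC').add
      ((tendsto_const_nhds.inner hT').pow 2))).congr fun i => ?_
    have := (hφ i).integral_inner_sq_mul (hm0 i).ne' v 0
    simp only [sub_zero] at this
    exact this.symm
  have h2 := hquad (fun x => (inner ℝ v x) ^ 2) (‖v‖ ^ 2) _ (by fun_prop) (fun x => sq_nonneg _)
    (fun x => by
      have h3 := pow_le_pow_left₀ (abs_nonneg _) (abs_real_inner_le_norm v x) 2
      rw [sq_abs, mul_pow] at h3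
      nlinarith [sq_nonneg ‖v‖]) h1
  have h3 := hφν.integral_inner_sq_mul hm1.ne' v 0
  simp only [sub_zero] at h3
  rw [h3, hTφ] at h2
  linarith [le_of_mul_le_mul_left h2 hm1]

/-- MCD functionals exist if no hyperplane has mass `γ` or more. -/
theorem MCD_nonempty [IsFiniteMeasure μ] (hμ1 : μ.real Set.univ ≤ 1) (hγ : 0 < γ)
    (hγμ : γ < μ.real Set.univ)
    (hH : ∀ (a : Rk k) (b : ℝ), a ≠ 0 → μ.real {x | inner ℝ a x = b} < γ) :
    (MCD γ μ).Nonempty := by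
  obtain ⟨ρ, hρ0, hρ⟩ := exists_lt_measureReal_closedBall hγμ
  set S : Set ℝ := (fun φ => (trimmedCov μ φ).det) '' trimmingClass μ γ with hS
  have hSne : S.Nonempty := ⟨_, _, mem_trimmingClass.2
    ⟨isTrimming_indicator_closedBall ρ, (integral_indicator_closedBall ρ).symm ▸ hρ.le⟩, rfl⟩
  have hSbdd : BddBelow S := ⟨0, by
    rintro _ ⟨φ, hφ, rfl⟩
    obtain ⟨h1, h2⟩ := mem_trimmingClass.1 hφ
    exact (h1.posSemidef_trimmedCov (hγ.trans_le h2)).det_nonneg⟩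
  have hseq : ∀ n : ℕ, ∃ φ ∈ trimmingClass μ γ, (trimmedCov μ φ).det < sInf S + 1 / (n + 1) := by
    intro n
    obtain ⟨_, ⟨φ, hφ, rfl⟩, h⟩ := exists_lt_of_csInf_lt hSne
      (lt_add_of_pos_right (sInf S) (by positivity : (0 : ℝ) < 1 / (n + 1)))
    exact ⟨φ, hφ, h⟩
  choose φs hφs hdet using hseq
  have hT : ∀ n, IsTrimming μ (φs n) := fun n => (mem_trimmingClass.1 (hφs n)).1
  have hm : ∀ n, γ ≤ ∫ x, φs n x ∂μ := fun n => (mem_trimmingClass.1 (hφs n)).2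
  obtain ⟨δ, hδ, c', hc', -, hslab⟩ := exists_slab_bound hγ hH
  obtain ⟨e, he, M, hM, hbound⟩ := exists_uniform_bounds hδ one_pos hγ hc' hslab (sInf S + 1)
  have hb := fun n => hbound μ (φs n) hμ1 (by simp) (hT n) (hγ.trans_le (hm n)) (hm n)
    ((hdet n).le.trans (by
      have : (1 : ℝ) / (n + 1) ≤ 1 := by rw [div_le_one (by positivity)]; simp
      linarith))
  obtain ⟨s, ⟨T, C⟩, hs, hlim⟩ := exists_subseq_tendsto (M := M)
    (x := fun n => (trimmedMean μ (φs n), trimmedCov μ (φs n))) (Eventually.of_forall fun n =>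
      ⟨(hb n).2.2, fun i j => ((hT n).abs_trimmedCov_apply_le (hγ.trans_le (hm n)) i j).trans
        (hb n).2.1⟩)
  have hlimT : Tendsto (fun n => trimmedMean μ (φs (s n))) atTop (𝓝 T) :=
    (continuous_fst.tendsto _).comp hlim
  have hlimC : Tendsto (fun n => trimmedCov μ (φs (s n))) atTop (𝓝 C) :=
    (continuous_snd.tendsto _).comp hlim
  -- Direct method: semicontinuity along the constant family `μ`, applied to a minimizing sequence.
  obtain ⟨φ, hφ, -, hps⟩ := exists_trimming_of_tendsto (locallyTendsto_const atTop μ)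
    (Eventually.of_forall fun _ => hμ1) (fun n => hT (s n)) hγ (fun n => hm (s n)) hlimT hlimC
  obtain ⟨hφ1, hφ2⟩ := mem_trimmingClass.1 hφ
  have hCφ := hφ1.posSemidef_trimmedCov (hγ.trans_le hφ2)
  have hCpos : C.PosDef := by
    have h1 : C.IsHermitian := by
      simpa using hps.1.add (isHermitian_trimmedCov μ φ)
    exact posDef_of_le_qform h1 he fun v =>
      ge_of_tendsto' (((continuous_qform v).tendsto C).comp hlimC) fun n => (hb (s n)).1 v
  have hdC : C.det ≤ sInf S := by
    have h1 : Tendsto (fun n => sInf S + 1 / ((s n : ℝ) + 1)) atTop (𝓝 (sInf S)) := by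
      simpa using (tendsto_one_div_add_atTop_nhds_zero_nat.comp hs.tendsto_atTop).const_add (sInf S)
    exact le_of_tendsto_of_tendsto' ((continuous_id.matrix_det.tendsto C).comp hlimC) h1
      fun n => (hdet (s n)).le
  exact ⟨_, φ, ⟨hφ, fun ψ hψ => ((det_le_det_of_sub_posSemidef hCpos hCφ hps).trans hdC).trans
    (csInf_le hSbdd ⟨ψ, hψ, rfl⟩)⟩, rfl⟩

/-- Perturbations `μs` of `ν`, along `l`, for which MCD functionals of level `γ` are stable:
`c` bounds the masses of the hyperplanes under `ν` and is asymptotically a lower bound for the mass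
under `ν` of the admissible trimming functions. -/
structure StablePerturbation (l : Filter ι) (μs : ι → Measure (Rk k)) (ν : Measure (Rk k))
    (γ c : ℝ) : Prop where
  locallyTendsto : LocallyTendsto l μs ν
  real_univ_le : ν.real Set.univ ≤ 1
  lt_real_univ : γ < ν.real Set.univ
  pos : 0 < c
  le : c ≤ γ
  hyperplane_lt : ∀ (a : Rk k) (b : ℝ), a ≠ 0 → ν.real {x | inner ℝ a x = b} < c
  eventually_real_univ_le : ∀ᶠ i in l, (μs i).real Set.univ ≤ 1
  eventually_smul_le : ∀ᶠ i in l, ENNReal.ofReal (1 / 2) • ν ≤ μs i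
  eventually_le_integral : ∀ d < c, ∀ᶠ i in l, ∀ φ, IsTrimming (μs i) φ →
    γ ≤ ∫ x, φ x ∂(μs i) → d ≤ ∫ x, φ x ∂ν

namespace StablePerturbation

variable {l : Filter ι} {μs : ι → Measure (Rk k)} {c : ℝ}

theorem gamma_pos (h : StablePerturbation l μs ν γ c) : 0 < γ := h.pos.trans_le h.le

theorem comp (h : StablePerturbation l μs ν γ c) {ι' : Type*} {l' : Filter ι'} {u : ι' → ι}
    (hu : Tendsto u l' l) : StablePerturbation l' (μs ∘ u) ν γ c where
  locallyTendsto := h.locallyTendsto.comp hu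
  real_univ_le := h.real_univ_le
  lt_real_univ := h.lt_real_univ
  pos := h.pos
  le := h.le
  hyperplane_lt := h.hyperplane_lt
  eventually_real_univ_le := hu.eventually h.eventually_real_univ_le
  eventually_smul_le := hu.eventually h.eventually_smul_le
  eventually_le_integral d hd := hu.eventually (h.eventually_le_integral d hd)

/-- Lets every result on the perturbed measures be applied to `ν` itself. -/
theorem const (h : StablePerturbation l μs ν γ c) {ι' : Type*} (l' : Filter ι') :
    StablePerturbation l' (fun _ => ν) ν γ γ where
  locallyTendsto := locallyTendsto_const l' ν
  real_univ_le := h.real_univ_le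
  lt_real_univ := h.lt_real_univ
  pos := h.gamma_pos
  le := le_rfl
  hyperplane_lt a b ha := (h.hyperplane_lt a b ha).trans_le h.le
  eventually_real_univ_le := .of_forall fun _ => h.real_univ_le
  eventually_smul_le := .of_forall fun _ => by
    intro s
    rw [Measure.smul_apply, smul_eq_mul]
    exact mul_le_of_le_one_left' (ENNReal.ofReal_le_one.2 (by norm_num))
  eventually_le_integral d hd := .of_forall fun _ φ _ hφ => hd.le.trans hφ

variable [IsFiniteMeasure ν]

theorem nonempty (h : StablePerturbation l μs ν γ c) : (MCD γ ν).Nonempty :=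
  MCD_nonempty h.real_univ_le h.gamma_pos h.lt_real_univ fun a b ha =>
    (h.hyperplane_lt a b ha).trans_le h.le

variable [∀ i, IsFiniteMeasure (μs i)]

/-- A ball of `ν`-mass above `γ` is eventually an admissible competitor, so minimal determinants are
at most `exp (ρ ^ 2)` and the uniform moment bounds apply. -/
theorem eventually_bounds (h : StablePerturbation l μs ν γ c) :
    ∃ e > 0, ∃ M > 0, ∃ ρ > 0, ∀ᶠ i in l, γ < (μs i).real (Metric.closedBall 0 ρ) ∧
      ∀ φ, IsMinimizingTrimming (μs i) γ φ →
        (∀ v, e * ‖v‖ ^ 2 ≤ qform (trimmedCov (μs i) φ) v) ∧ (trimmedCov (μs i) φ).trace ≤ M ∧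
          ‖trimmedMean (μs i) φ‖ ≤ M := by
  obtain ⟨ρ, hρ0, hρ⟩ := exists_lt_measureReal_closedBall h.lt_real_univ
  obtain ⟨δ, hδ, c', hc', hc0, hslab⟩ := exists_slab_bound h.pos h.hyperplane_lt
  -- The retained mass is only asymptotically at least `c`, so an intermediate `d` that still
  -- exceeds the slab bound `c'` is used.
  obtain ⟨d, hcd, hdc⟩ := exists_between hc'
  obtain ⟨e, he, M, hM, hbound⟩ := exists_uniform_bounds hδ (a := 1 / 2) (by norm_num)
    (hc0.trans_lt hcd) hcd hslab (Real.exp (ρ ^ 2))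
  have hball : ∀ᶠ i in l, γ < (μs i).real (Metric.closedBall 0 ρ) := by
    have h1 := h.locallyTendsto.tendsto_sub
      (f := fun _ => (Metric.closedBall (0 : Rk k) ρ).indicator 1) (ρ := ρ) (K := 1)
      (fun _ => (isTrimming_indicator_closedBall (μ := ν) ρ).measurable)
      (fun _ => (isTrimming_indicator_closedBall (μ := ν) ρ).abs_le_one)
      fun _ x hx => Set.indicator_of_notMem (by simpa using hx) _
    simp only [integral_indicator_closedBall] at h1
    filter_upwards [h1.eventually_const_lt (sub_neg.2 hρ)] with i hi
    linarith
  refine ⟨e, he, M, hM, ρ, hρ0, ?_⟩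
  filter_upwards [hball, h.eventually_real_univ_le, h.eventually_smul_le,
    h.eventually_le_integral d hdc] with i h1 h2 h3 h4
  refine ⟨h1, fun φ hφ => ?_⟩
  refine hbound (μs i) φ h2 h3 hφ.isTrimming (h.gamma_pos.trans_le hφ.le_integral)
    (h4 φ hφ.isTrimming hφ.le_integral) ?_
  refine (hφ.2 _ (mem_trimmingClass.2 ⟨isTrimming_indicator_closedBall ρ, ?_⟩)).trans
    (det_trimmedCov_indicator_closedBall_le (h.gamma_pos.trans h1))
  rw [integral_indicator_closedBall]
  exact h1.le

/-- MCD functionals are attained at trimming functions with uniformly bounded support. -/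
theorem eventually_exists_bounded_support (h : StablePerturbation l μs ν γ c) :
    ∃ R, ∀ᶠ i in l, ∀ p ∈ MCD γ (μs i), ∃ ψ, IsMinimizingTrimming (μs i) γ ψ ∧
      ∫ x, ψ x ∂(μs i) = γ ∧ (∀ x, R < ‖x‖ → ψ x = 0) ∧
      p = (trimmedMean (μs i) ψ, trimmedCov (μs i) ψ) := by
  obtain ⟨e, he, M, hM, ρ, hρ, hev⟩ := h.eventually_bounds
  set R := M + 1 + M * ((ρ + M) ^ 2 / e) with hR
  refine ⟨R, ?_⟩
  filter_upwards [hev] with i hi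
  rintro _ ⟨φ, hφ, rfl⟩
  obtain ⟨φ', hφ', hm', hT', hC'⟩ := hφ.exists_integral_eq h.gamma_pos
  obtain ⟨h1, h2, h3⟩ := hi.2 φ' hφ'
  have hae := hφ'.ae_eq_zero_of_bounds h.gamma_pos hm' he hM hρ h1 h2 h3 hi.1
  -- The exchange argument gives vanishing almost everywhere; cutting off at the ball makes it hold
  -- everywhere with the same moments.
  have hae' : (Metric.closedBall (0 : Rk k) R).indicator φ' =ᵐ[μs i] φ' := by
    filter_upwards [hae] with x hx
    by_cases hxB : x ∈ Metric.closedBall (0 : Rk k) R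
    · rw [Set.indicator_of_mem hxB]
    · rw [Set.indicator_of_notMem hxB, hx (by simpa using hxB)]
  have hψ := hφ'.isTrimming.indicator
    (Metric.isClosed_closedBall (x := (0 : Rk k)) (ε := R)).measurableSet
  obtain ⟨hT, hC⟩ := trimmedMean_eq_and_trimmedCov_eq hψ hφ'.isTrimming one_ne_zero fun f _ => by
    rw [one_mul]
    refine integral_congr_ae ?_
    filter_upwards [hae'] with x hx
    rw [hx]
  have hm := (integral_congr_ae hae').trans hm'
  refine ⟨_, ⟨mem_trimmingClass.2 ⟨hψ, hm.ge⟩, fun χ hχ => ?_⟩, hm,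
    fun x hx => Set.indicator_of_notMem (by simpa using hx) _, ?_⟩
  · rw [hC]
    exact hφ'.2 χ hχ
  · rw [hT, hC, hT', hC']

omit [∀ i, IsFiniteMeasure (μs i)] in
theorem exists_bounded_support (h : StablePerturbation l μs ν γ c) :
    ∃ R, ∀ p ∈ MCD γ ν, ∃ ψ, IsMinimizingTrimming ν γ ψ ∧
      ∫ x, ψ x ∂ν = γ ∧ (∀ x, R < ‖x‖ → ψ x = 0) ∧ p = (trimmedMean ν ψ, trimmedCov ν ψ) := by
  obtain ⟨R, hR⟩ := (h.const (⊤ : Filter Unit)).eventually_exists_bounded_support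
  exact ⟨R, hR ()⟩

end StablePerturbation

end MCDLimits

/-! ### Convergence of MCD functionals, and their equality when measures agree on a ball. -/

section MCDStability

open Matrix

variable {k : ℕ} {μ ν : Measure (Rk k)} {φ ψ : Rk k → ℝ} {γ : ℝ} {ι : Type*}

theorem LocallyTendsto.tendsto_integral {l : Filter ι} {μs : ι → Measure (Rk k)}
    (h : LocallyTendsto l μs ν) (hψ : IsTrimming ν ψ) {R : ℝ} (hR : ∀ x, R < ‖x‖ → ψ x = 0)
    {f : Rk k → ℝ} (hf : Measurable f) {L : ℝ} (hL : ∀ x, ‖x‖ ≤ R → |f x| ≤ L) :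
    Tendsto (fun i => ∫ x, f x * ψ x ∂(μs i)) l (𝓝 (∫ x, f x * ψ x ∂ν)) := by
  have h1 := h.tendsto_sub (f := fun _ x => f x * ψ x) (ρ := R) (K := |L|)
    (fun _ => hf.mul hψ.measurable) (fun _ x => ?_) fun _ x hx => by rw [hR x hx, mul_zero]
  · simpa using h1.add_const (∫ x, f x * ψ x ∂ν)
  · rcases le_or_gt ‖x‖ R with hx | hx
    · rw [abs_mul]
      exact (mul_le_of_le_one_right (abs_nonneg _) (hψ.abs_le_one x)).trans
        ((hL x hx).trans (le_abs_self L))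
    · rw [hR x hx, mul_zero, abs_zero]
      exact abs_nonneg L

theorem LocallyTendsto.tendsto_trimmed {l : Filter ι} {μs : ι → Measure (Rk k)}
    [IsFiniteMeasure ν] [∀ i, IsFiniteMeasure (μs i)] (h : LocallyTendsto l μs ν)
    (hψ : IsTrimming ν ψ) {R : ℝ} (hR : ∀ x, R < ‖x‖ → ψ x = 0) (hm : ∫ x, ψ x ∂ν ≠ 0) :
    Tendsto (fun i => ∫ x, ψ x ∂(μs i)) l (𝓝 (∫ x, ψ x ∂ν)) ∧
      Tendsto (fun i => (trimmedMean (μs i) ψ, trimmedCov (μs i) ψ)) l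
        (𝓝 (trimmedMean ν ψ, trimmedCov ν ψ)) := by
  have h0 : Tendsto (fun i => ∫ x, ψ x ∂(μs i)) l (𝓝 (∫ x, ψ x ∂ν)) := by
    simpa using h.tendsto_integral hψ hR (f := fun _ => 1) measurable_const (L := 1)
      fun x _ => by simp
  refine ⟨h0, tendsto_trimmed_of_tendsto_moments
    (.of_forall fun i => .of_bounded_support hψ.measurable hψ.mem_Icc hR) hψ hm h0
    (fun a => h.tendsto_integral hψ hR (by fun_prop) fun x hx => (abs_apply_le x a).trans hx)
    fun a b => h.tendsto_integral hψ hR (f := fun x => x a * x b) (L := R * R) (by fun_prop)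
      fun x hx => ?_⟩
  rw [abs_mul]
  have := norm_nonneg x
  exact mul_le_mul ((abs_apply_le x a).trans hx) ((abs_apply_le x b).trans hx) (abs_nonneg _)
    (by linarith)

namespace StablePerturbation

variable {l : Filter ι} {μs : ι → Measure (Rk k)} {c : ℝ} [IsFiniteMeasure ν]

/-- The minimal determinant is approached by trimming functions of bounded support whose mass
exceeds the prescribed level. -/
theorem exists_seq_trimming (h : StablePerturbation l μs ν γ c) :
    ∃ (ψs : ℕ → Rk k → ℝ) (R : ℝ) (d : ℝ), (∀ n, IsTrimming ν (ψs n)) ∧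
      (∀ n x, R < ‖x‖ → ψs n x = 0) ∧ (∀ n, γ < ∫ x, ψs n x ∂ν) ∧
      Tendsto (fun n => (trimmedCov ν (ψs n)).det) atTop (𝓝 d) ∧
      ∀ ψ ∈ trimmingClass ν γ, d ≤ (trimmedCov ν ψ).det := by
  obtain ⟨R₁, hR₁⟩ := h.exists_bounded_support
  obtain ⟨p, hp⟩ := h.nonempty
  obtain ⟨ψ, hψ, hm, hsupp, -⟩ := hR₁ p hp
  obtain ⟨ρ, hρ0, hρ⟩ := exists_lt_measureReal_closedBall h.lt_real_univ
  have hψt := hψ.isTrimming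
  set χ : Rk k → ℝ := (Metric.closedBall (0 : Rk k) ρ).indicator 1 with hχ
  have hχt : IsTrimming ν χ := isTrimming_indicator_closedBall ρ
  have hχm : ∫ x, χ x ∂ν = ν.real (Metric.closedBall 0 ρ) := integral_indicator_closedBall ρ
  set t : ℕ → ℝ := fun n => 1 / ((n : ℝ) + 1) with ht
  have ht0 : ∀ n, 0 < t n := fun n => by simp only [ht]; positivity
  have ht1 : ∀ n, t n ≤ 1 := fun n => by
    simp only [ht]; rw [div_le_one (by positivity)]; simp
  have htl : Tendsto t atTop (𝓝 0) := tendsto_one_div_add_atTop_nhds_zero_nat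
  -- A minimizer of mass exactly `γ` at `ν` may have mass below `γ` at `μs i`. Mixing in a little of
  -- the indicator of a ball of mass above `γ` gives slack that survives the perturbation.
  set ψs : ℕ → Rk k → ℝ := fun n x => ψ x + t n * (χ x - ψ x) with hψs
  have hsupps : ∀ n x, max R₁ ρ < ‖x‖ → ψs n x = 0 := fun n x hx => by
    have h1 := hsupp x ((le_max_left _ _).trans_lt hx)
    have h2 : χ x = 0 :=
      Set.indicator_of_notMem (by simpa using (le_max_right _ _).trans_lt hx) _
    simp [hψs, h1, h2]
  have htr : ∀ n, IsTrimming ν (ψs n) := fun n => by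
    refine .of_bounded_support (hψt.measurable.add
      ((hχt.measurable.sub hψt.measurable).const_mul _)) (fun x => ?_) (hsupps n)
    have h1 := hψt.mem_Icc x
    have h2 := hχt.mem_Icc x
    have h3 := ht0 n
    have h4 := ht1 n
    have e : ψs n x = (1 - t n) * ψ x + t n * χ x := by simp only [hψs]; ring
    rw [e]
    constructor
    · have := mul_nonneg (sub_nonneg.2 h4) h1.1
      have := mul_nonneg h3.le h2.1
      linarith
    · have := mul_le_mul_of_nonneg_left h1.2 (sub_nonneg.2 h4)
      have := mul_le_mul_of_nonneg_left h2.2 h3.le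
      linarith
  have hint : ∀ (f : Rk k → ℝ), Integrable (fun x => f x * ψ x) ν →
      Integrable (fun x => f x * χ x) ν → ∀ n, ∫ x, f x * ψs n x ∂ν =
        ∫ x, f x * ψ x ∂ν + t n * (∫ x, f x * χ x ∂ν - ∫ x, f x * ψ x ∂ν) := by
    intro f h1 h2 n
    have e1 := integral_add h1 ((h2.sub h1).const_mul (t n))
    simp only [Pi.sub_apply] at e1
    rw [← integral_sub h2 h1, ← integral_const_mul, ← e1]
    exact integral_congr_ae (ae_of_all _ fun x => by simp only [hψs]; ring)
  have hlim : ∀ (f : Rk k → ℝ), Integrable (fun x => f x * ψ x) ν →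
      Integrable (fun x => f x * χ x) ν →
      Tendsto (fun n => ∫ x, f x * ψs n x ∂ν) atTop (𝓝 (∫ x, f x * ψ x ∂ν)) := by
    intro f h1 h2
    simp only [hint f h1 h2]
    simpa using (htl.mul_const _).const_add (∫ x, f x * ψ x ∂ν)
  have hmn : ∀ n, ∫ x, ψs n x ∂ν = γ + t n * (ν.real (Metric.closedBall 0 ρ) - γ) := fun n => by
    have := hint (fun _ => 1) (by simpa using hψt.integrable) (by simpa using hχt.integrable) n
    simpa only [one_mul, hm, hχm] using this
  refine ⟨ψs, max R₁ ρ, (trimmedCov ν ψ).det, htr, hsupps, fun n => ?_, ?_, hψ.2⟩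
  · rw [hmn]
    linarith [mul_pos (ht0 n) (sub_pos.2 hρ)]
  · have h0 := hlim (fun _ => 1) (by simpa using hψt.integrable) (by simpa using hχt.integrable)
    simp only [one_mul] at h0
    have hmc := tendsto_trimmed_of_tendsto_moments (l := atTop) (μs := fun _ => ν)
      (.of_forall htr) hψt (by rw [hm]; exact h.gamma_pos.ne')
      h0 (fun a => hlim _ (hψt.integrable_apply_mul a) (hχt.integrable_apply_mul a))
      (fun a b => hlim (fun x => x a * x b)
        (by simpa using hψt.integrable_sub_mul_sub_mul 0 a b)
        (by simpa using hχt.integrable_sub_mul_sub_mul 0 a b))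
    exact (continuous_id.matrix_det.tendsto _).comp ((continuous_snd.tendsto _).comp hmc)

variable [∀ i, IsFiniteMeasure (μs i)]

/-- Limit points of MCD functionals of `μs` are MCD functionals of `ν`. -/
theorem mem_MCD_of_tendsto [l.NeBot] (h : StablePerturbation l μs ν γ c)
    {x : ι → Rk k × Matrix (Fin k) (Fin k) ℝ} (hx : ∀ i, x i ∈ MCD γ (μs i))
    {y : Rk k × Matrix (Fin k) (Fin k) ℝ} (hy : Tendsto x l (𝓝 y)) : y ∈ MCD γ ν := by
  choose φs hφs hxφ using hx
  obtain ⟨T, C⟩ := y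
  have hyT : Tendsto (fun i => trimmedMean (μs i) (φs i)) l (𝓝 T) :=
    ((continuous_fst.tendsto _).comp hy).congr fun i => by simp [hxφ]
  have hyC : Tendsto (fun i => trimmedCov (μs i) (φs i)) l (𝓝 C) :=
    ((continuous_snd.tendsto _).comp hy).congr fun i => by simp [hxφ]
  obtain ⟨φ, hφ, hTφ, hps⟩ := exists_trimming_of_tendsto h.locallyTendsto
    h.eventually_real_univ_le (fun i => (hφs i).isTrimming) h.gamma_pos
    (fun i => (hφs i).le_integral) hyT hyC
  obtain ⟨e, he, _, _, _, _, hev⟩ := h.eventually_bounds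
  obtain ⟨hφt, hφm⟩ := mem_trimmingClass.1 hφ
  have hC : C.PosDef := by
    have h1 : C.IsHermitian := by simpa using hps.1.add (isHermitian_trimmedCov ν φ)
    exact posDef_of_le_qform h1 he fun v =>
      ge_of_tendsto (((continuous_qform v).tendsto C).comp hyC)
        (hev.mono fun i hi => (hi.2 _ (hφs i)).1 v)
  obtain ⟨ψs, R, d, hψ, hR, hψm, hd, hmin⟩ := h.exists_seq_trimming
  -- For fixed `n`, `ψs n` is eventually admissible at `μs i`, and its bounded support makes its
  -- moments there converge to those at `ν`.
  have hCd : C.det ≤ d := by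
    refine ge_of_tendsto' hd fun n => ?_
    obtain ⟨h1, h2⟩ := h.locallyTendsto.tendsto_trimmed (hψ n) (hR n)
      (h.gamma_pos.trans (hψm n)).ne'
    refine le_of_tendsto_of_tendsto ((continuous_id.matrix_det.tendsto C).comp hyC)
      ((continuous_id.matrix_det.tendsto _).comp ((continuous_snd.tendsto _).comp h2)) ?_
    filter_upwards [h1.eventually_const_lt (hψm n)] with i hi
    exact (hφs i).2 _ (mem_trimmingClass.2
      ⟨.of_bounded_support (hψ n).measurable (hψ n).mem_Icc (hR n), hi.le⟩)
  have hCφ := hφt.posSemidef_trimmedCov (h.gamma_pos.trans_le hφm)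
  -- `C` dominates the covariance of `φ` but its determinant is no larger, so no second moment was
  -- lost in the limit.
  have heq := eq_of_sub_posSemidef_of_det_le hC hCφ hps (hCd.trans (hmin φ hφ))
  refine ⟨φ, ⟨hφ, fun ψ hψ' => ?_⟩, by rw [hTφ, heq]⟩
  rw [heq]
  exact hCd.trans (hmin ψ hψ')

theorem limitPointsIn (h : StablePerturbation l μs ν γ c)
    (hne : ∀ᶠ i in l, (MCD γ (μs i)).Nonempty) :
    LimitPointsIn l (fun i => MCD γ (μs i)) (MCD γ ν) := by
  refine ⟨hne, fun u x hu hx => ⟨?_, fun s y hs hy => ?_⟩⟩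
  · obtain ⟨_, _, M, _, _, _, hev⟩ := h.eventually_bounds
    refine exists_subseq_tendsto (M := M) ?_
    filter_upwards [hu.eventually hev] with n hn
    obtain ⟨φ, hφ, hxφ⟩ := hx n
    obtain ⟨-, h2, h3⟩ := hn.2 φ hφ
    rw [hxφ]
    exact ⟨h3, fun i j => (hφ.isTrimming.abs_trimmedCov_apply_le
      (h.gamma_pos.trans_le hφ.le_integral) i j).trans h2⟩
  · have : ∀ n, IsFiniteMeasure ((μs ∘ u ∘ s) n) := fun n => inferInstanceAs
      (IsFiniteMeasure (μs (u (s n))))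
    exact (h.comp (hu.comp hs.tendsto_atTop)).mem_MCD_of_tendsto (fun n => hx (s n)) hy

end StablePerturbation

/-- If `μ` and `ν` agree on a ball, the MCD functionals at `μ` are attained at trimming functions
supported in it and some minimizing trimming function at `ν` is supported in it, then the MCD
functionals at `μ` are MCD functionals at `ν`. -/
theorem MCD_subset_of_forall_integral_eq [IsFiniteMeasure μ] [IsFiniteMeasure ν]
    {R : ℝ} (hμν : ∀ f : Rk k → ℝ, (∀ x, R < ‖x‖ → f x = 0) → ∫ x, f x ∂μ = ∫ x, f x ∂ν)
    (hμ : ∀ p ∈ MCD γ μ, ∃ ψ, IsMinimizingTrimming μ γ ψ ∧ (∀ x, R < ‖x‖ → ψ x = 0) ∧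
      p = (trimmedMean μ ψ, trimmedCov μ ψ))
    (hν : ∃ ψ, IsMinimizingTrimming ν γ ψ ∧ ∀ x, R < ‖x‖ → ψ x = 0) : MCD γ μ ⊆ MCD γ ν := by
  have key : ∀ ψ : Rk k → ℝ, Measurable ψ → (∀ x, ψ x ∈ Set.Icc (0 : ℝ) 1) →
      (∀ x, R < ‖x‖ → ψ x = 0) →
      trimmedMean μ ψ = trimmedMean ν ψ ∧ trimmedCov μ ψ = trimmedCov ν ψ :=
    fun ψ h1 h2 h3 => trimmedMean_eq_and_trimmedCov_eq (.of_bounded_support h1 h2 h3)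
      (.of_bounded_support h1 h2 h3) one_ne_zero fun f _ => by
        rw [one_mul]
        exact hμν _ fun x hx => by rw [h3 x hx, mul_zero]
  intro p hp
  obtain ⟨ψ, hψ, hψR, rfl⟩ := hμ p hp
  obtain ⟨χ, hχ, hχR⟩ := hν
  obtain ⟨hT, hC⟩ := key ψ hψ.isTrimming.measurable hψ.isTrimming.mem_Icc hψR
  obtain ⟨-, hCχ⟩ := key χ hχ.isTrimming.measurable hχ.isTrimming.mem_Icc hχR
  have h1 : ψ ∈ trimmingClass ν γ := mem_trimmingClass.2
    ⟨.of_bounded_support hψ.isTrimming.measurable hψ.isTrimming.mem_Icc hψR,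
      hμν ψ hψR ▸ hψ.le_integral⟩
  have h2 : χ ∈ trimmingClass μ γ := mem_trimmingClass.2
    ⟨.of_bounded_support hχ.isTrimming.measurable hχ.isTrimming.mem_Icc hχR,
      (hμν χ hχR).symm ▸ hχ.le_integral⟩
  refine ⟨ψ, ⟨h1, fun ξ hξ => ?_⟩, by rw [hT, hC]⟩
  calc (trimmedCov ν ψ).det = (trimmedCov μ ψ).det := by rw [hC]
    _ ≤ (trimmedCov μ χ).det := hψ.2 χ h2
    _ = (trimmedCov ν χ).det := by rw [hCχ]
    _ ≤ (trimmedCov ν ξ).det := hχ.2 ξ hξ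

end MCDStability

/-! ### The contaminated measures as stable perturbations. -/

section Contamination

open Matrix

variable {k : ℕ} {P Q : Measure (Rk k)} {γ ε η : ℝ} {r : Rk k}

/-- Normalisation cancels the factor in the trimmed moments; only the mass constraint sees it. -/
theorem MCD_ofReal_smul {a : ℝ} (ha : 0 < a) (γ : ℝ) (P : Measure (Rk k)) :
    MCD γ (ENNReal.ofReal a • P) = MCD (γ / a) P := by
  have hr : (ENNReal.ofReal a).toReal = a := ENNReal.toReal_ofReal ha.le
  have hT : ∀ φ, trimmedMean (ENNReal.ofReal a • P) φ = trimmedMean P φ := fun φ => by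
    simp only [trimmedMean, integral_smul_measure, hr, smul_eq_mul, smul_smul, mul_inv]
    rw [mul_right_comm, inv_mul_cancel₀ ha.ne', one_mul]
  have hC : ∀ φ, trimmedCov (ENNReal.ofReal a • P) φ = trimmedCov P φ := fun φ => by
    ext i j
    simp only [trimmedCov, hT, of_apply, integral_smul_measure, hr, smul_eq_mul, mul_inv]
    rw [mul_mul_mul_comm, inv_mul_cancel₀ ha.ne', one_mul]
  have hK : trimmingClass (ENNReal.ofReal a • P) γ = trimmingClass P (γ / a) := by
    ext φ
    simp only [trimmingClass, Set.mem_ofPred_eq, integral_smul_measure, hr, smul_eq_mul,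
      integrable_smul_measure (ENNReal.ofReal_ne_zero_iff.2 ha) ENNReal.ofReal_ne_top,
      div_le_iff₀ ha, mul_comm a]
  simp only [MCD, IsMinimizingTrimming, hT, hC, hK]

theorem measurable_add_rk (r : Rk k) : Measurable fun x : Rk k => x + r :=
  measurable_id.add_const r

instance isFiniteMeasure_contaminated [IsFiniteMeasure P] [IsFiniteMeasure Q] (r : Rk k) (η : ℝ) :
    IsFiniteMeasure (contaminated P Q r η) := by
  have h1 := P.smul_finite (ENNReal.ofReal_ne_top (r := 1 - η))
  have h2 := (Q.map fun x => x + r).smul_finite (ENNReal.ofReal_ne_top (r := η))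
  unfold contaminated
  infer_instance

theorem smul_le_contaminated (P Q : Measure (Rk k)) (r : Rk k) (η : ℝ) :
    ENNReal.ofReal (1 - η) • P ≤ contaminated P Q r η :=
  Measure.le_add_right le_rfl

theorem integral_contaminated [IsFiniteMeasure P] [IsFiniteMeasure Q] (h0 : 0 ≤ η) (h1 : η ≤ 1)
    {f : Rk k → ℝ} (hf : Measurable f) (hf1 : ∀ x, |f x| ≤ 1) :
    ∫ x, f x ∂(contaminated P Q r η) = (1 - η) * ∫ x, f x ∂P + η * ∫ x, f (x + r) ∂Q := by
  have hi : ∀ (μ : Measure (Rk k)) [IsFiniteMeasure μ], Integrable f μ := fun μ _ =>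
    .of_bound hf.aestronglyMeasurable 1 (ae_of_all _ hf1)
  rw [contaminated, integral_add_measure ((hi P).smul_measure ENNReal.ofReal_ne_top)
    ((hi _).smul_measure ENNReal.ofReal_ne_top), integral_smul_measure, integral_smul_measure,
    integral_map (measurable_add_rk r).aemeasurable hf.aestronglyMeasurable,
    ENNReal.toReal_ofReal h0, ENNReal.toReal_ofReal (by linarith), smul_eq_mul, smul_eq_mul]

theorem abs_integral_le_one [IsProbabilityMeasure Q] {f : Rk k → ℝ} (hf1 : ∀ x, |f x| ≤ 1) :
    |∫ x, f x ∂Q| ≤ 1 := by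
  simpa using norm_integral_le_of_norm_le_const (μ := Q) (f := f) (C := 1) (ae_of_all _ hf1)

theorem measureReal_contaminated_le [IsFiniteMeasure P] [IsProbabilityMeasure Q] (h0 : 0 ≤ η)
    (h1 : η ≤ 1) (A : Set (Rk k)) (hA : MeasurableSet A) :
    (contaminated P Q r η).real A ≤ (1 - η) * P.real A + η := by
  have h2 := integral_contaminated (P := P) (Q := Q) (r := r) h0 h1
    (f := A.indicator 1) (measurable_one.indicator hA) fun x => by
      by_cases hx : x ∈ A <;> simp [hx]
  rw [integral_indicator_one hA, integral_indicator_one hA] at h2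
  have h3 : |∫ x, A.indicator (1 : Rk k → ℝ) (x + r) ∂Q| ≤ 1 := abs_integral_le_one fun x => by
    by_cases hx : x + r ∈ A <;> simp [hx]
  rw [h2]
  have := mul_le_mul_of_nonneg_left (abs_le.1 h3).2 h0
  linarith

theorem measureReal_univ_contaminated [IsProbabilityMeasure P] [IsProbabilityMeasure Q]
    (h0 : 0 ≤ η) (h1 : η ≤ 1) : (contaminated P Q r η).real Set.univ = 1 := by
  have := integral_contaminated (P := P) (Q := Q) (r := r) h0 h1 (f := fun _ => 1)
    measurable_const fun _ => by simp
  simpa using this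

theorem measurableSet_hyperplane (a : Rk k) (b : ℝ) : MeasurableSet {x | inner ℝ a x = b} :=
  measurableSet_eq_fun (by fun_prop) measurable_const

/-- The uniform gap `c - c'` leaves room for a small contaminating mass on any hyperplane. -/
theorem exists_hyperplane_bound [IsFiniteMeasure P] {c : ℝ} (hc : 0 < c)
    (h : ∀ (a : Rk k) (b : ℝ), a ≠ 0 → P.real {x | inner ℝ a x = b} < c) :
    ∃ c' < c, ∀ (a : Rk k) (b : ℝ), a ≠ 0 → P.real {x | inner ℝ a x = b} ≤ c' := by
  obtain ⟨δ, hδ, c', hc', -, hslab⟩ := exists_slab_bound hc h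
  refine ⟨c', hc', fun a b ha => le_trans (measureReal_mono ?_ (measure_ne_top _ _))
    (hslab (‖a‖⁻¹ • a) (‖a‖⁻¹ * b)
      (by rw [norm_smul, norm_inv, norm_norm, inv_mul_cancel₀ (norm_ne_zero_iff.2 ha)]))⟩
  intro x hx
  have hx' : inner ℝ a x = b := hx
  simp [inner_smul_left, hx', hδ.le]

theorem stablePerturbation_contaminated_nhds [IsProbabilityMeasure P] [IsProbabilityMeasure Q]
    (hγ0 : 0 < γ) (hγ1 : γ < 1)
    (hP : ∀ (a : Rk k) (b : ℝ), a ≠ 0 → P.real {x | inner ℝ a x = b} < γ) (r : Rk k) :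
    StablePerturbation (𝓝[>] (0 : ℝ)) (fun η => contaminated P Q r η) P γ γ := by
  have hev : ∀ d > 0, ∀ᶠ η in 𝓝[>] (0 : ℝ), 0 ≤ η ∧ η ≤ d := fun d hd => by
    filter_upwards [Ioc_mem_nhdsGT hd] with η hη using ⟨hη.1.le, hη.2⟩
  refine ⟨fun ρ e he => ?_, by simp, by simpa, hγ0, le_rfl, hP, ?_, ?_, fun d hd => ?_⟩
  · filter_upwards [hev 1 one_pos, hev (e / 2) (half_pos he)] with η h1 h2 f hf hf1 _
    rw [integral_contaminated h1.1 h1.2 hf hf1]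
    have h3 : |∫ x, f x ∂P| ≤ 1 := abs_integral_le_one hf1
    have h4 : |∫ x, f (x + r) ∂Q| ≤ 1 := abs_integral_le_one fun x => hf1 _
    have e1 : (1 - η) * ∫ x, f x ∂P + η * ∫ x, f (x + r) ∂Q - ∫ x, f x ∂P =
        η * (∫ x, f (x + r) ∂Q - ∫ x, f x ∂P) := by ring
    rw [e1, abs_mul, abs_of_nonneg h1.1]
    have h5 := (abs_sub (∫ x, f (x + r) ∂Q) (∫ x, f x ∂P)).trans (add_le_add h4 h3)
    nlinarith [h1.1]
  · filter_upwards [hev 1 one_pos] with η h1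
    exact (measureReal_univ_contaminated h1.1 h1.2).le
  · filter_upwards [hev (1 / 2) (by norm_num)] with η h1
    refine le_trans ?_ (smul_le_contaminated P Q r η)
    intro s
    simp only [Measure.smul_apply, smul_eq_mul]
    gcongr
    linarith [h1.2]
  -- The contamination supplies mass at most `η`, so at least `γ - η ≥ d` comes from `P`.
  · filter_upwards [hev 1 one_pos, hev (γ - d) (by linarith)] with η h1 h2 φ hφ hφγ
    rw [integral_contaminated h1.1 h1.2 hφ.measurable hφ.abs_le_one] at hφγ
    have h3 : |∫ x, φ (x + r) ∂Q| ≤ 1 := abs_integral_le_one fun x => hφ.abs_le_one _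
    have h4 := mul_le_mul_of_nonneg_left (abs_le.1 h3).2 h1.1
    have h5 : 0 ≤ η * ∫ x, φ x ∂P := mul_nonneg h1.1 (integral_nonneg hφ.nonneg)
    linarith [h2.2]

theorem eventually_MCD_contaminated_nonempty [IsProbabilityMeasure P] [IsProbabilityMeasure Q]
    (hγ0 : 0 < γ) (hγ1 : γ < 1)
    (hP : ∀ (a : Rk k) (b : ℝ), a ≠ 0 → P.real {x | inner ℝ a x = b} < γ) (r : Rk k) :
    ∀ᶠ η in 𝓝[>] (0 : ℝ), (MCD γ (contaminated P Q r η)).Nonempty := by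
  obtain ⟨c', hc', hle⟩ := exists_hyperplane_bound hγ0 hP
  filter_upwards [Ioo_mem_nhdsGT (sub_pos.2 hc'), Ioo_mem_nhdsGT one_pos] with η h1 h2
  have hu := measureReal_univ_contaminated (P := P) (Q := Q) (r := r) h2.1.le h2.2.le
  refine MCD_nonempty hu.le hγ0 (by rwa [hu]) fun a b ha => ?_
  refine (measureReal_contaminated_le h2.1.le h2.2.le _ (measurableSet_hyperplane a b)).trans_lt ?_
  have h3 : 0 ≤ η * P.real {x | inner ℝ a x = b} := mul_nonneg h2.1.le measureReal_nonneg
  linarith [hle a b ha, h1.2]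

theorem MCD_contaminated_nonempty [IsProbabilityMeasure P] [IsProbabilityMeasure Q]
    (hε : 0 ≤ ε) (hε1 : ε ≤ 1) (hγ0 : 0 < γ) (hγ1 : γ < 1)
    (hP : ∀ (a : Rk k) (b : ℝ), a ≠ 0 → (1 - ε) * P.real {x | inner ℝ a x = b} < γ - ε)
    (r : Rk k) : (MCD γ (contaminated P Q r ε)).Nonempty := by
  have hu := measureReal_univ_contaminated (P := P) (Q := Q) (r := r) hε hε1
  refine MCD_nonempty hu.le hγ0 (by rwa [hu]) fun a b ha => ?_
  refine (measureReal_contaminated_le hε hε1 _ (measurableSet_hyperplane a b)).trans_lt ?_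
  linarith [hP a b ha]

/-- The translated part escapes to infinity, leaving `(1 - ε) P`. It can contribute at most `ε` to
the trimmed mass, hence the constant `γ - ε`. -/
theorem stablePerturbation_contaminated_cobounded [IsProbabilityMeasure P]
    [IsProbabilityMeasure Q] (hε : 0 ≤ ε) (hεγ : ε < γ) (hγε : γ < 1 - ε)
    (hP : ∀ (a : Rk k) (b : ℝ), a ≠ 0 → (1 - ε) * P.real {x | inner ℝ a x = b} < γ - ε) :
    StablePerturbation (Bornology.cobounded (Rk k)) (fun r => contaminated P Q r ε)
      (ENNReal.ofReal (1 - ε) • P) γ (γ - ε) := by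
  have hε1 : ε ≤ 1 := by linarith
  have hε2 : 0 ≤ 1 - ε := by linarith
  have hreal : ∀ A, (ENNReal.ofReal (1 - ε) • P).real A = (1 - ε) * P.real A := fun A => by
    rw [measureReal_ennreal_smul_apply, ENNReal.toReal_ofReal hε2]
  have hint : ∀ f : Rk k → ℝ, ∫ x, f x ∂(ENNReal.ofReal (1 - ε) • P) = (1 - ε) * ∫ x, f x ∂P :=
    fun f => by rw [integral_smul_measure, ENNReal.toReal_ofReal hε2, smul_eq_mul]
  refine ⟨fun ρ e he => ?_, by rw [hreal]; simpa using hε, by rw [hreal]; simpa using hγε,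
    by linarith, by linarith, fun a b ha => by rw [hreal]; exact hP a b ha, .of_forall fun r => ?_,
    .of_forall fun r => ?_, fun d hd => .of_forall fun r φ hφ hφγ => ?_⟩
  -- `Q` has mass less than `e` outside the ball of radius `R`; once `‖r‖ > R + ρ`, the translate of
  -- that ball misses the set where `f` may be nonzero.
  · obtain ⟨R, -, hR⟩ := exists_lt_measureReal_closedBall (μ := Q) (c := 1 - e)
      (by simpa using he)
    filter_upwards [(tendsto_norm_cobounded_atTop (E := Rk k)).eventually_gt_atTop (R + ρ)]
      with r hr f hf hf1 hfρ
    rw [integral_contaminated hε hε1 hf hf1, hint, add_sub_cancel_left, abs_mul,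
      abs_of_nonneg hε]
    have hB : MeasurableSet (Metric.closedBall (0 : Rk k) R) :=
      Metric.isClosed_closedBall.measurableSet
    have h1 : |∫ x, f (x + r) ∂Q| ≤ ∫ x, (Metric.closedBall (0 : Rk k) R)ᶜ.indicator 1 x ∂Q := by
      rw [← Real.norm_eq_abs]
      refine norm_integral_le_of_norm_le ((integrable_const (1 : ℝ)).indicator hB.compl)
        (ae_of_all _ fun x => ?_)
      by_cases hx : x ∈ Metric.closedBall (0 : Rk k) R
      · have hx' : ‖x‖ ≤ R := by simpa using hx
        rw [hfρ (x + r)]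
        · simp [hx]
        · have := norm_sub_le_norm_add r x
          rw [add_comm]
          linarith
      · simpa [Set.indicator_of_mem (Set.mem_compl hx)] using hf1 (x + r)
    rw [integral_indicator_one hB.compl, measureReal_compl hB, probReal_univ] at h1
    have h2 : |∫ x, f (x + r) ∂Q| ≤ e := by linarith
    calc ε * |∫ x, f (x + r) ∂Q| ≤ 1 * e := mul_le_mul hε1 h2 (abs_nonneg _) zero_le_one
      _ = e := one_mul e
  · exact (measureReal_univ_contaminated hε hε1).le
  · refine le_trans ?_ (smul_le_contaminated P Q r ε)
    intro s
    rw [Measure.smul_apply, smul_eq_mul]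
    exact mul_le_of_le_one_left' (ENNReal.ofReal_le_one.2 (by norm_num))
  · rw [integral_contaminated hε hε1 hφ.measurable hφ.abs_le_one] at hφγ
    have h3 : |∫ x, φ (x + r) ∂Q| ≤ 1 := abs_integral_le_one fun x => hφ.abs_le_one _
    have h4 := mul_le_mul_of_nonneg_left (abs_le.1 h3).2 hε
    rw [hint]
    linarith

theorem integral_contaminated_eq_of_support {ρ s : ℝ} (hQ : Q.support ⊆ Metric.closedBall 0 s)
    (hr : ρ + s < ‖r‖) {f : Rk k → ℝ} (hf : ∀ x, ρ < ‖x‖ → f x = 0) :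
    ∫ x, f x ∂(contaminated P Q r ε) = ∫ x, f x ∂(ENNReal.ofReal (1 - ε) • P) := by
  set B := Metric.closedBall (0 : Rk k) ρ with hB
  have hBm : MeasurableSet B := Metric.isClosed_closedBall.measurableSet
  have hsupp : ∀ x ∉ B, f x = 0 := fun x hx => hf x (by simpa [hB] using hx)
  rw [← setIntegral_eq_integral_of_forall_compl_eq_zero hsupp,
    ← setIntegral_eq_integral_of_forall_compl_eq_zero (μ := ENNReal.ofReal (1 - ε) • P) hsupp]
  congr 1
  have h0 : (Q.map fun x => x + r) B = 0 := by
    rw [Measure.map_apply (measurable_add_rk r) hBm]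
    refine measure_mono_null (t := Q.supportᶜ) ?_ Q.measure_compl_support
    intro x hx hxs
    have h1 : ‖x + r‖ ≤ ρ := mem_closedBall_zero_iff.1 hx
    have h2 : ‖x‖ ≤ s := by simpa using hQ hxs
    have := norm_sub_le_norm_add r x
    rw [add_comm] at h1
    linarith
  rw [contaminated, Measure.restrict_add, Measure.restrict_smul (ENNReal.ofReal ε),
    Measure.restrict_eq_zero.2 h0, smul_zero, add_zero]

end Contamination

/-! ### The theorem. -/

theorem mainTheorem8 {k : ℕ} (P Q : Measure (Rk k)) [IsProbabilityMeasure P]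
    [IsProbabilityMeasure Q] (ε γ : ℝ) (hε : 0 ≤ ε) (hεγ : ε < γ) (hγε : γ < 1 - ε)
    (hP : ∀ (a : Rk k) (b : ℝ), a ≠ 0 → P.real {x | inner ℝ a x = b} < (γ - ε) / (1 - ε)) :
    (∀ r : Rk k, LimitPointsIn (𝓝[>] (0 : ℝ)) (fun η => MCD γ (contaminated P Q r η))
      (MCD γ P)) ∧
    LimitPointsIn (Bornology.cobounded (Rk k)) (fun r => MCD γ (contaminated P Q r ε))
      (MCD (γ / (1 - ε)) P) ∧
    (Bornology.IsBounded Q.support →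
      ∃ r₀ : ℝ, 0 ≤ r₀ ∧ ∀ r : Rk k, r₀ ≤ ‖r‖ →
        MCD γ (contaminated P Q r ε) = MCD (γ / (1 - ε)) P) := by
  have hγ0 : 0 < γ := hε.trans_lt hεγ
  have hε1 : 0 < 1 - ε := hγ0.trans hγε
  have hγ1 : γ < 1 := by linarith
  have hPγ : ∀ (a : Rk k) (b : ℝ), a ≠ 0 → P.real {x | inner ℝ a x = b} < γ := fun a b ha => by
    refine (hP a b ha).trans_le ?_
    rw [div_le_iff₀ hε1]
    nlinarith
  have hPε : ∀ (a : Rk k) (b : ℝ), a ≠ 0 →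
      (1 - ε) * P.real {x | inner ℝ a x = b} < γ - ε := fun a b ha => by
    have := hP a b ha
    rwa [lt_div_iff₀ hε1, mul_comm] at this
  have hν : IsFiniteMeasure (ENNReal.ofReal (1 - ε) • P) := P.smul_finite ENNReal.ofReal_ne_top
  have hstable := stablePerturbation_contaminated_cobounded (Q := Q) hε hεγ hγε hPε
  have hne := MCD_contaminated_nonempty (Q := Q) hε (by linarith) hγ0 hγ1 hPε
  rw [← MCD_ofReal_smul hε1]
  refine ⟨fun r => (stablePerturbation_contaminated_nhds hγ0 hγ1 hPγ r).limitPointsIn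
    (eventually_MCD_contaminated_nonempty hγ0 hγ1 hPγ r),
    hstable.limitPointsIn (.of_forall hne), fun hQ => ?_⟩
  obtain ⟨R₁, hR₁⟩ := hstable.eventually_exists_bounded_support
  obtain ⟨R₂, hR₂⟩ := hstable.exists_bounded_support
  obtain ⟨s, hs⟩ := hQ.subset_closedBall 0
  have hev : ∀ᶠ r in Bornology.cobounded (Rk k),
      MCD γ (contaminated P Q r ε) = MCD γ (ENNReal.ofReal (1 - ε) • P) := by
    filter_upwards [hR₁, (tendsto_norm_cobounded_atTop (E := Rk k)).eventually_gt_atTop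
      (max R₁ R₂ + s)] with r hr hrs
    have hagree : ∀ f : Rk k → ℝ, (∀ x, max R₁ R₂ < ‖x‖ → f x = 0) →
        ∫ x, f x ∂(contaminated P Q r ε) = ∫ x, f x ∂(ENNReal.ofReal (1 - ε) • P) :=
      fun f hf => integral_contaminated_eq_of_support hs hrs hf
    have hμ : ∀ p ∈ MCD γ (contaminated P Q r ε), ∃ ψ,
        IsMinimizingTrimming (contaminated P Q r ε) γ ψ ∧ (∀ x, max R₁ R₂ < ‖x‖ → ψ x = 0) ∧
        p = (trimmedMean (contaminated P Q r ε) ψ, trimmedCov (contaminated P Q r ε) ψ) :=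
      fun p hp => by
        obtain ⟨ψ, h1, -, h2, h3⟩ := hr p hp
        exact ⟨ψ, h1, fun x hx => h2 x ((le_max_left _ _).trans_lt hx), h3⟩
    have hν' : ∀ p ∈ MCD γ (ENNReal.ofReal (1 - ε) • P), ∃ ψ,
        IsMinimizingTrimming (ENNReal.ofReal (1 - ε) • P) γ ψ ∧
        (∀ x, max R₁ R₂ < ‖x‖ → ψ x = 0) ∧
        p = (trimmedMean (ENNReal.ofReal (1 - ε) • P) ψ,
          trimmedCov (ENNReal.ofReal (1 - ε) • P) ψ) :=
      fun p hp => by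
        obtain ⟨ψ, h1, -, h2, h3⟩ := hR₂ p hp
        exact ⟨ψ, h1, fun x hx => h2 x ((le_max_right _ _).trans_lt hx), h3⟩
    -- Each inclusion needs a minimizer of the other problem supported in the common ball, so
    -- existence on both sides is used.
    obtain ⟨p, hp⟩ := hne r
    obtain ⟨q, hq⟩ := hstable.nonempty
    obtain ⟨ψ, hψ, hψR, -⟩ := hμ p hp
    obtain ⟨χ, hχ, hχR, -⟩ := hν' q hq
    exact (MCD_subset_of_forall_integral_eq hagree hμ ⟨χ, hχ, hχR⟩).antisymm
      (MCD_subset_of_forall_integral_eq (fun f hf => (hagree f hf).symm) hν' ⟨ψ, hψ, hψR⟩)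
  obtain ⟨r₀, -, hr₀⟩ := (hasBasis_cobounded_norm (E := Rk k)).eventually_iff.1 hev
  exact ⟨max r₀ 0, le_max_right _ _, fun r hr => hr₀ ((le_max_left _ _).trans hr)⟩
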